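/- **Theorem (generating function of a sum of $T$-independent natural elements).** Let $E$ be a Dedekind complete Riesz space with weak order unit $e\ge 0$, and let $T:E\to E$ be a strictly positive, order continuous linear projection with $Te=e$ whose range $R(T)$ is a Dedekind complete Riesz subspace of $E$. Let $E^s$ be the sup-completion of $E$, to which $T$ is extended by $T(\sup_\alpha y_\alpha)=\sup_\alpha Ty_\alpha$ for $y_\alpha\uparrow$ in $E$. The product on the positive cone $E^s_+$ is the one with unit $e$, i.e. the extension, bilinear and compatible with suprema, of $p\cdot q=p\wedge q$ for components $p,q$ of $e$ (so $0\cdot\infty=0$). For $x\in E$ let $P_x$ be the band projection onto the band generated by $x$, put $P_{x=te}=I-P_{|x-te|}$ and $\pi_x(t)=TP_{x=te}e$ for $t\in\mathbb R$. Call $x$ *natural* if $\sum_{n\ge 0}\pi_x(n)=e$ in order. For natural $x$ and real $s\ge 0$ put $g_x(s)=\sum_{n\ge0}s^n\pi_x(n)\in E^s$ (with $0^0=1$), the supremum of the partial sums in $E^s$. Band projections $(P_i)_{i\in I}$ are *$T$-independent* if $TP_{i_1}\cdots P_{i_k}T=TP_{i_1}TP_{i_2}\cdots TP_{i_k}T$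 for all distinct $i_1,\dots,i_k\in I$. Elements $(x_i)_{i\in I}$ of $E$ are *$T$-independent* if every family of band projections $(P_i)_{i\in I}$, with $P_ie$ in the order closed Riesz subspace generated by $x_i$ and $R(T)$ for each $i$, is $T$-independent. Let $x_1,\dots,x_n$ be $T$-independent natural elements of $E$ and $S_n=x_1+\cdots+x_n$. Then $S_n$ is natural and, for every real $s\ge 0$, $$g_{S_n}(s)=T s^{S_n}=g_{x_1}(s)\cdots g_{x_n}(s)\quad\text{in }E^s .$$ Here $s^{S_n}\in E^s$ is the value at $S_n$ of the function $t\mapsto s^t$ (for $s=0$: the indicator function of $\{0\}$) in the Daniell functional calculus, that is, the extended Daniell integral of that function with respect to the spectral system $e_t=P_{S_n\le te}\,e=e-P_{(S_n-te)^+}e$; it is part of the claim that this value is well defined. For $n=0$ the empty product is $e$. -/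

import Mathlib

namespace RieszGen

/-! ### Sup-completion -/

/-- The sup-completion `E^s` of a Dedekind complete Riesz space `E`. An element `x` of `E^s` is
the supremum of, and is determined by, the set `{y ∈ E : y ≤ x}`; the sets arising in this way are
exactly the nonempty lower subsets of `E` which are closed under all suprema that exist in `E`.
So `E^s` is realised as the collection of these sets. It has a largest element (all of `E`). -/
@[ext]
structure SupCompletion (E : Type*) [Preorder E] where
  carrier : Set E
  nonempty' : carrier.Nonempty
  lower' : IsLowerSet carrier
  lub_mem' : ∀ B : Set E, B ⊆ carrier → B.Nonempty → ∀ b : E, IsLUB B b → b ∈ carrier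

namespace SupCompletion

/-- The order of `E^s`. -/
instance {E : Type*} [Preorder E] : PartialOrder (SupCompletion E) where
  le A B := A.carrier ⊆ B.carrier
  le_refl _ := Set.Subset.rfl
  le_trans _ _ _ h h' := Set.Subset.trans h h'
  le_antisymm _ _ h h' := SupCompletion.ext (Set.Subset.antisymm h h')

/-- The embedding `E → E^s`. -/
def of {E : Type*} [Preorder E] (x : E) : SupCompletion E where
  carrier := Set.Iic x
  nonempty' := ⟨x, le_rfl⟩
  lower' := isLowerSet_Iic x
  lub_mem' := fun _ hB _ _ hb => hb.2 fun _ hc => hB hc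

theorem of_le_iff {E : Type*} [Preorder E] (x : E) (A : SupCompletion E) :
    of x ≤ A ↔ x ∈ A.carrier :=
  ⟨fun h => h le_rfl, fun h _ hy => A.lower' hy h⟩

/-- The supremum in `E^s` of a nonempty subset `S` of `E`. -/
def supOf {E : Type*} [Preorder E] (S : Set E) (hS : S.Nonempty) : SupCompletion E where
  carrier := {y | ∀ A : SupCompletion E, S ⊆ A.carrier → y ∈ A.carrier}
  nonempty' := hS.imp fun _ hx _ hA => hA hx
  lower' := fun _ _ hba ha A hA => A.lower' hba (ha A hA)
  lub_mem' := fun B hB hne b hb A hA => A.lub_mem' B (fun _ hc => hB hc A hA) hne b hb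

theorem isLUB_supOf {E : Type*} [Preorder E] (S : Set E) (hS : S.Nonempty) :
    IsLUB (of '' S) (supOf S hS) := by
  constructor
  · rintro _ ⟨x, hx, rfl⟩
    exact (of_le_iff x _).2 fun A hA => hA hx
  · intro A hA y hy
    exact hy A fun x hx => (of_le_iff x A).1 (hA ⟨x, hx, rfl⟩)

/-- The sum `A + u` of an element `A` of `E^s` and an element `u` of `E`. -/
def translate {E : Type*} [Lattice E] [AddCommGroup E] [IsOrderedAddMonoid E]
    (A : SupCompletion E) (u : E) : SupCompletion E where
  carrier := {y | y - u ∈ A.carrier}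
  nonempty' := by
    obtain ⟨a, ha⟩ := A.nonempty'
    exact ⟨a + u, by simpa using ha⟩
  lower' := fun _ _ hba ha => A.lower' (sub_le_sub_right hba u) ha
  lub_mem' := by
    intro B hB hne b hb
    refine A.lub_mem' ((fun y => y - u) '' B) ?_ (hne.image _) _ ⟨?_, ?_⟩
    · rintro _ ⟨y, hy, rfl⟩
      exact hB hy
    · rintro _ ⟨y, hy, rfl⟩
      exact sub_le_sub_right (hb.1 hy) u
    · intro c hc
      exact sub_le_iff_le_add.2 (hb.2 fun y hy => sub_le_iff_le_add.1 (hc ⟨y, hy, rfl⟩))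

end SupCompletion

open SupCompletion

/-! ### Band projections and conditional expectations -/

section Riesz

variable {E : Type*} [ConditionallyCompleteLattice E] [AddCommGroup E] [IsOrderedAddMonoid E]
  [Module ℝ E] [IsOrderedModule ℝ E]

/-- `P_x y`, where `P_x` is the band projection onto the principal band generated by `x`:
`P_x y = sup_n (y ∧ n|x|)` for `y ≥ 0`, and `P_x y = P_x y⁺ - P_x y⁻` in general. -/
noncomputable def bandProj (x y : E) : E :=
  (⨆ n : ℕ, y⁺ ⊓ n • |x|) - ⨆ n : ℕ, y⁻ ⊓ n • |x|

/-- An order (band) projection on `E`: a linear projection `P` with `0 ≤ P ≤ I`. -/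
structure IsBandProjection (P : E →ₗ[ℝ] E) : Prop where
  idem : ∀ x, P (P x) = P x
  nonneg : ∀ x, 0 ≤ x → 0 ≤ P x
  le_self : ∀ x, 0 ≤ x → P x ≤ x

/-- `(E, e, T)` is a conditional Riesz triple: `e` is a weak order unit of the Dedekind complete
Riesz space `E`, and `T` is a strictly positive order continuous linear projection with `T e = e`
whose range is a Dedekind complete Riesz subspace. -/
structure IsConditionalTriple (e : E) (T : E →ₗ[ℝ] E) : Prop where
  unit_nonneg : 0 ≤ e
  unit_weak : ∀ x : E, |x| ⊓ e = 0 → x = 0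
  nonneg : ∀ x, 0 ≤ x → 0 ≤ T x
  strictly_pos : ∀ x, 0 < x → 0 < T x
  order_cont : ∀ D : Set E, D.Nonempty → DirectedOn (fun a b => b ≤ a) D → IsGLB D 0 →
    IsGLB (T '' D) 0
  idem : ∀ x, T (T x) = T x
  map_unit : T e = e
  range_sup : ∀ x ∈ Set.range T, ∀ y ∈ Set.range T, x ⊔ y ∈ Set.range T
  range_complete : ∀ A : Set (Set.range T), A.Nonempty → BddAbove A → ∃ b, IsLUB A b

/-! ### `T`-independence -/

/-- `T`-independence of a family of band projections: for every finite list of distinct indices,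
`T P₁ P₂ ⋯ Pₙ T = T P₁ T P₂ ⋯ T Pₙ T`. -/
def IndepProj (T : E →ₗ[ℝ] E) {ι : Type*} (P : ι → E →ₗ[ℝ] E) : Prop :=
  ∀ l : List ι, l.Nodup → ∀ y : E,
    T (l.foldr (fun i z => P i z) (T y)) = l.foldr (fun i z => T (P i z)) (T y)

/-- An (order) closed Riesz subspace. Because of `sup_mem`, closedness under arbitrary suprema
is the same as closedness under suprema of upward directed subsets, hence (taking negatives) under
infima of downward directed subsets and under order limits of nets. -/
structure IsClosedRieszSubspace (F : Submodule ℝ E) : Prop where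
  sup_mem : ∀ x ∈ F, ∀ y ∈ F, x ⊔ y ∈ F
  lub_mem : ∀ A : Set E, A ⊆ F → A.Nonempty → ∀ a, IsLUB A a → a ∈ F

/-- The closed Riesz subspace generated by a set. -/
def closedRieszSpan (S : Set E) : Submodule ℝ E :=
  sInf {F | IsClosedRieszSubspace F ∧ S ⊆ F}

/-- `T`-independence of a family of subspaces. -/
def IndepSubspaces (e : E) (T : E →ₗ[ℝ] E) {ι : Type*} (F : ι → Submodule ℝ E) : Prop :=
  ∀ P : ι → E →ₗ[ℝ] E, (∀ i, IsBandProjection (P i)) → (∀ i, P i e ∈ F i) → IndepProj T P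

/-- `T`-independence of a family `x` of elements: the closed Riesz subspaces
`⟨x i, R(T)⟩` are `T`-independent. -/
def IndepElements (e : E) (T : E →ₗ[ℝ] E) {ι : Type*} (x : ι → E) : Prop :=
  IndepSubspaces e T fun i => closedRieszSpan (insert (x i) (Set.range T))

/-! ### Natural elements and generating functions -/

/-- The mass function `π_x(t) = T P_{x = te} e`, where `P_{x = te} = I - P_{|x - te|}`. -/
noncomputable def massFun (e : E) (T : E →ₗ[ℝ] E) (x : E) (t : ℝ) : E :=
  T (e - bandProj |x - t • e| e)

/-- `x` is natural: `∑_{n ≥ 0} π_x(n) = e` in order. The partial sums increase,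
so their order limit is their supremum. -/
def IsNatural (e : E) (T : E →ₗ[ℝ] E) (x : E) : Prop :=
  IsLUB (Set.range fun N : ℕ => ∑ n ∈ Finset.range N, massFun e T x n) e

/-- The generating function `g_x(s) = ∑_{n ≥ 0} sⁿ π_x(n) ∈ E^s`, for `s ≥ 0`: the supremum in
`E^s` of the increasing partial sums. -/
noncomputable def genFun (e : E) (T : E →ₗ[ℝ] E) (x : E) (s : ℝ) : SupCompletion E :=
  supOf (Set.range fun N : ℕ => ∑ n ∈ Finset.range N, s ^ n • massFun e T x n)
    (Set.range_nonempty _)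

/-- The extension of `T` to `E^s`: `T (sup_α y_α) = sup_α T y_α`. -/
def extend (T : E →ₗ[ℝ] E) (A : SupCompletion E) : SupCompletion E :=
  supOf (T '' A.carrier) (A.nonempty'.image T)

/-- The product on the positive cone of `E^s` with unit `e`. For components `p, q` of `e` and
reals `α, β ≥ 0` one has `(αp)(βq) = αβ (p ∧ q)`; the product of two positive elements `A`, `B`
is the supremum of all `(αp)(βq)` with `αp ≤ A` and `βq ≤ B`, so that it is the unique extension
of the product of components that is bilinear and preserves suprema (and `0 · ∞ = 0`). On positive
elements of the universal completion it is the product of the f-algebra `E^u` with unit `e`.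
For `A, B ≥ 0` inserting `0` changes nothing. -/
def mul (e : E) (A B : SupCompletion E) : SupCompletion E :=
  supOf (insert 0 {z | ∃ (a b : ℝ) (p q : E), 0 ≤ a ∧ 0 ≤ b ∧ p ⊓ (e - p) = 0 ∧ q ⊓ (e - q) = 0 ∧
    of (a • p) ≤ A ∧ of (b • q) ≤ B ∧ z = (a * b) • (p ⊓ q)}) (Set.insert_nonempty _ _)

/-- The product of a finite list in the positive cone of `E^s` (the empty product is `e`). -/
def prodList (e : E) (l : List (SupCompletion E)) : SupCompletion E :=
  l.foldr (mul e) (of e)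

/-! ### The Daniell functional calculus -/

/-- The right continuous spectral system of `x`: `e_t = P_{x ≤ te} e = e - P_{(x - te)⁺} e`,
with `e_{-∞} = 0` and `e_{∞} = e`. -/
noncomputable def spectral (e x : E) (t : EReal) : E :=
  if t = ⊥ then 0 else if t = ⊤ then e else e - bandProj (x - t.toReal • e)⁺ e

/-- Formal finite linear combinations `∑ c · 1_{(a,b]}` of indicators of intervals
`(a,b] ∩ ℝ` with `a, b ∈ [-∞, ∞]`; they represent the `𝓕(ℝ)`-step functions. -/
abbrev Step := (EReal × EReal) →₀ ℝ

/-- The step function represented by a formal combination. -/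
noncomputable def Step.eval (φ : Step) (t : ℝ) : ℝ :=
  φ.sum fun J c => Set.indicator {r : ℝ | J.1 < (r : EReal) ∧ (r : EReal) ≤ J.2} (fun _ => c) t

/-- The elementary integral `I_x(∑ c · 1_{(a,b]}) = ∑ c (e_b - e_a)`
(`(a,b]` is empty when `b < a`). -/
noncomputable def Step.integral (e x : E) (φ : Step) : E :=
  φ.sum fun J c => c • (spectral e x (max J.1 J.2) - spectral e x J.1)

/-- `f ∈ L^↑` and `I_x(f) = A`: there are step functions `φ_n ↑ f` (pointwise), and `A ∈ E^s` is
the supremum of the `I_x(φ_n)`. -/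
def HasUpIntegral (e x : E) (f : ℝ → EReal) (A : SupCompletion E) : Prop :=
  ∃ φ : ℕ → Step, (∀ t, Monotone fun n => (φ n).eval t) ∧
    (∀ t, IsLUB (Set.range fun n => ((φ n).eval t : EReal)) (f t)) ∧
    A = supOf (Set.range fun n => (φ n).integral e x) (Set.range_nonempty _)

/-- `h ∈ L₁^↑` and `I_x(h) = u`: `h` is a real nonnegative function in `L^↑` whose integral
is an element `u` of `E`. -/
def HasUpIntegralIn (e x : E) (h : ℝ → ℝ) (u : E) : Prop :=
  (∀ t, 0 ≤ h t) ∧ HasUpIntegral e x (fun t => (h t : EReal)) (of u)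

/-- `f ∈ L₂ = L^↑ - L₁`, where `L₁ = L₁^↑ - L₁^↑`, and `f(x) = I_x(f) = A`: one can write
`f = g - (h₁ - h₂)` with `g ∈ L^↑`, `h₁, h₂ ∈ L₁^↑`, and `A = I_x(g) - (I_x(h₁) - I_x(h₂))`. -/
def HasFunctionalValue (e x : E) (f : ℝ → EReal) (A : SupCompletion E) : Prop :=
  ∃ (g : ℝ → EReal) (h₁ h₂ : ℝ → ℝ) (G : SupCompletion E) (u₁ u₂ : E),
    HasUpIntegral e x g G ∧ HasUpIntegralIn e x h₁ u₁ ∧ HasUpIntegralIn e x h₂ u₂ ∧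
    (∀ t, f t = g t - ((h₁ t - h₂ t : ℝ) : EReal)) ∧ A = G.translate (-(u₁ - u₂))

end Riesz

end RieszGen

namespace RieszGen

open SupCompletion

set_option linter.unusedSectionVars false

/-! ### Truncations and principal band projections in a Dedekind complete lattice-ordered group. -/

section Basics

variable {E : Type*} [ConditionallyCompleteLattice E] [AddCommGroup E] [IsOrderedAddMonoid E]

/-! Cut E into pieces on which the elements are constant multiples of e. If x is natural, strict
positivity of T forces the disjoint components P_{x=k}e, k = 0, 1, ..., to have supremum e already
before T is applied (`IsNatural.isLevels`), and inequalities in E can then be checked piece by piece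
(`IsPartition.le_of_forall_le`). The products P_{x=k}P_{y=m}, grouped by l = k + m, cut E into
levels of x + y (`IsLevels.add`). Such a partition is unique (`IsLevels.levelProj_eq`), so x + y is
natural and its masses are the sums of T P_{x=k}P_{y=m}e over k + m = l.

On the k-th piece the spectral system of x jumps from 0 to e at k, so a Daniell integral of f equals
f(k)e there. Hence a functional value depends only on the numbers f(k) and is unique
(`carrier_of_hasFunctionalValue`), and applying T gives the generating function
(`genFun_eq_extend`). Existence comes from dyadic layers, because superlevel sets of t ↦ s^t are
half-open intervals.

For the product, independence gives T P_k Q_m e = T P_k T Q_m e, where P_k, Q_m are the pieces of x,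
y. The operator L_n = T ∘ ∑_{k<n} s^k P_k commutes with every band projection Q such that Qe is in
R(T), hence acts on the partial sums b_n of g_y as multiplication by L_n e, the partial sum of g_x.
So L_n b_n, a sum over a square of index pairs, is the product of two partial sums, while g_{x+y}
sums over triangles. Comparing squares with triangles, and using that the product on E^s respects
increasing suprema (`apply_mem_mul`, `mul_supOf_le`), gives g_{x+y} = g_x g_y
(`genSup_convPartition`). Induction over the list of summands finishes the proof. -/

theorem nonpos_of_forall_nsmul_le {x y : E} (h : ∀ n : ℕ, n • x ≤ y) : x ≤ 0 := by
  have hL : IsLUB (Set.range fun n : ℕ => n • x) (⨆ n : ℕ, n • x) :=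
    isLUB_ciSup ⟨y, by rintro _ ⟨n, rfl⟩; exact h n⟩
  -- Adding x to a multiple of x gives a multiple again, so the supremum absorbs x.
  have : (⨆ n : ℕ, n • x) ≤ (⨆ n : ℕ, n • x) - x := by
    refine hL.2 ?_
    rintro _ ⟨n, rfl⟩
    refine le_sub_iff_add_le.2 ?_
    have := hL.1 ⟨n + 1, rfl⟩
    simpa [succ_nsmul] using this
  simpa using this

/-- Meeting with y is a contraction, so y ⊓ a - w lies below every a - f i, and these have infimum
0. -/
theorem isLUB_inf_left {ι : Type*} {f : ι → E} {a : E} (h : IsLUB (Set.range f) a) (y : E) :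
    IsLUB (Set.range fun i => y ⊓ f i) (y ⊓ a) := by
  refine ⟨?_, fun w hw => ?_⟩
  · rintro _ ⟨i, rfl⟩
    exact inf_le_inf_left _ (h.1 ⟨i, rfl⟩)
  · have key : a ≤ a - (y ⊓ a - w) := by
      refine h.2 ?_
      rintro _ ⟨i, rfl⟩
      have h1 : |a ⊓ y - f i ⊓ y| ≤ |a - f i| := abs_inf_sub_inf_le_abs _ _ _
      rw [abs_of_nonneg (sub_nonneg.2 (h.1 ⟨i, rfl⟩))] at h1
      have h2 : a ⊓ y - f i ⊓ y ≤ a - f i := (le_abs_self _).trans h1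
      have h3 : f i ⊓ y ≤ w := by rw [inf_comm]; exact hw ⟨i, rfl⟩
      have h4 : y ⊓ a - w ≤ a - f i := by
        rw [inf_comm]
        exact (sub_le_sub_left h3 _).trans h2
      exact le_sub_comm.1 h4
    have : y ⊓ a - w ≤ 0 := by simpa using key
    exact sub_nonpos.1 this

theorem inf_add_le {x y z : E} (hx : 0 ≤ x) (hy : 0 ≤ y) (hz : 0 ≤ z) :
    (x + y) ⊓ z ≤ x ⊓ z + y ⊓ z := by
  rw [inf_add, add_inf, add_inf]
  refine le_inf (le_inf inf_le_left ?_) (le_inf ?_ ?_)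
  · exact inf_le_right.trans (le_add_of_nonneg_left hx)
  · exact inf_le_right.trans (le_add_of_nonneg_right hy)
  · exact inf_le_right.trans (le_add_of_nonneg_left hz)

theorem isLUB_truncation (c : E) (y : E) :
    IsLUB (Set.range fun n : ℕ => y ⊓ n • c) (⨆ n : ℕ, y ⊓ n • c) :=
  isLUB_ciSup ⟨y, by rintro _ ⟨n, rfl⟩; exact inf_le_left⟩

theorem truncation_add {c y z : E} (hc : 0 ≤ c) (hy : 0 ≤ y) (hz : 0 ≤ z) :
    (⨆ n : ℕ, (y + z) ⊓ n • c) = (⨆ n : ℕ, y ⊓ n • c) + ⨆ n : ℕ, z ⊓ n • c := by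
  have hm : ∀ {m n : ℕ}, m ≤ n → m • c ≤ n • c := fun h => nsmul_le_nsmul_left hc h
  refine le_antisymm ((isLUB_truncation c _).2 ?_) ?_
  · rintro _ ⟨n, rfl⟩
    exact (inf_add_le hy hz (nsmul_nonneg hc n)).trans
      (add_le_add ((isLUB_truncation c y).1 ⟨n, rfl⟩) ((isLUB_truncation c z).1 ⟨n, rfl⟩))
  · rw [← le_sub_iff_add_le]
    refine (isLUB_truncation c y).2 ?_
    rintro _ ⟨n, rfl⟩
    rw [le_sub_comm]
    refine (isLUB_truncation c z).2 ?_
    rintro _ ⟨m, rfl⟩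
    rw [le_sub_iff_add_le, add_comm]
    refine le_trans (le_inf (add_le_add inf_le_left inf_le_left) ?_)
      ((isLUB_truncation c (y + z)).1 ⟨n + m, rfl⟩)
    rw [add_nsmul]
    exact add_le_add inf_le_right inf_le_right

/-- Rearranged so that both sides are sums of positive elements, where `truncation_add` applies. -/
theorem posPart_add_add (y z : E) :
    (y + z)⁺ + (y⁻ + z⁻) = (y⁺ + z⁺) + (y + z)⁻ := by
  have h1 := posPart_sub_negPart y
  have h2 := posPart_sub_negPart z
  have h3 := posPart_sub_negPart (y + z)
  have : (y + z)⁺ - (y + z)⁻ = (y⁺ - y⁻) + (z⁺ - z⁻) := by rw [h1, h2, h3]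
  rw [← sub_eq_zero] at this ⊢
  rw [← this]; abel

theorem bandProj_add (x y z : E) : bandProj x (y + z) = bandProj x y + bandProj x z := by
  have hp := fun a : E => posPart_nonneg a
  have hn := fun a : E => negPart_nonneg a
  have hx := abs_nonneg x
  have h := congrArg (fun a : E => ⨆ n : ℕ, a ⊓ n • |x|) (posPart_add_add y z)
  rw [truncation_add hx (hp _) (add_nonneg (hn _) (hn _)), truncation_add hx (hn _) (hn _),
    truncation_add hx (add_nonneg (hp _) (hp _)) (hn _), truncation_add hx (hp _) (hp _)] at h
  unfold bandProj
  rw [← sub_eq_zero] at h ⊢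
  rw [← h]; abel

theorem bandProj_of_nonneg (x : E) {y : E} (hy : 0 ≤ y) :
    bandProj x y = ⨆ n : ℕ, y ⊓ n • |x| := by
  have h0 : ∀ n : ℕ, (0 : E) ⊓ n • |x| = 0 := fun n => inf_eq_left.2 (nsmul_nonneg (abs_nonneg x) n)
  simp [bandProj, posPart_of_nonneg hy, negPart_of_nonneg hy, h0]

theorem isLUB_bandProj (x : E) {y : E} (hy : 0 ≤ y) :
    IsLUB (Set.range fun n : ℕ => y ⊓ n • |x|) (bandProj x y) := by
  rw [bandProj_of_nonneg x hy]
  exact isLUB_truncation _ _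

theorem bandProj_neg (x y : E) : bandProj x (-y) = -bandProj x y := by
  simp [bandProj]

theorem bandProj_nonneg (x : E) {y : E} (hy : 0 ≤ y) : 0 ≤ bandProj x y := by
  have := (isLUB_bandProj x hy).1 ⟨0, rfl⟩
  simpa [inf_eq_right.2 hy] using this

theorem bandProj_le_self (x : E) {y : E} (hy : 0 ≤ y) : bandProj x y ≤ y := by
  refine (isLUB_bandProj x hy).2 ?_
  rintro _ ⟨n, rfl⟩
  exact inf_le_left

theorem bandProj_idem_of_nonneg (x : E) {y : E} (hy : 0 ≤ y) :
    bandProj x (bandProj x y) = bandProj x y := by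
  refine le_antisymm (bandProj_le_self x (bandProj_nonneg x hy)) ((isLUB_bandProj x hy).2 ?_)
  rintro _ ⟨n, rfl⟩
  refine le_trans (le_inf ?_ inf_le_right) ((isLUB_bandProj x (bandProj_nonneg x hy)).1 ⟨n, rfl⟩)
  exact (isLUB_bandProj x hy).1 ⟨n, rfl⟩

end Basics

/-! ### Algebra of band projections on a Dedekind complete Riesz space. -/

section Module

variable {E : Type*} [ConditionallyCompleteLattice E] [AddCommGroup E] [IsOrderedAddMonoid E]
  [Module ℝ E] [IsOrderedModule ℝ E]

theorem smul_le_smul_left' {r : ℝ} (hr : 0 ≤ r) {a b : E} (h : a ≤ b) : r • a ≤ r • b :=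
  smul_le_smul_of_nonneg_left h hr

theorem smul_inf_of_nonneg {r : ℝ} (hr : 0 ≤ r) (a b : E) : r • (a ⊓ b) = r • a ⊓ r • b := by
  rcases hr.eq_or_lt with rfl | hr'
  · simp
  · refine le_antisymm (le_inf (smul_le_smul_left' hr inf_le_left)
      (smul_le_smul_left' hr inf_le_right)) ?_
    have h := smul_le_smul_left' hr (le_inf (c := r⁻¹ • (r • a ⊓ r • b)) (a := a) (b := b) ?_ ?_)
    · rwa [smul_inv_smul₀ hr'.ne'] at h
    · have := smul_le_smul_left' (inv_nonneg.2 hr) (inf_le_left : r • a ⊓ r • b ≤ r • a)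
      rwa [inv_smul_smul₀ hr'.ne'] at this
    · have := smul_le_smul_left' (inv_nonneg.2 hr) (inf_le_right : r • a ⊓ r • b ≤ r • b)
      rwa [inv_smul_smul₀ hr'.ne'] at this

theorem nonpos_of_forall_le_smul {v u : E} (h : ∀ δ : ℝ, 0 < δ → v ≤ δ • u) : v ≤ 0 := by
  refine nonpos_of_forall_nsmul_le (y := u⁺) fun n => ?_
  rcases Nat.eq_zero_or_pos n with rfl | hn
  · simp
  · have hn' : (0 : ℝ) < n := by exact_mod_cast hn
    have := smul_le_smul_left' hn'.le (h ((n : ℝ)⁻¹) (inv_pos.2 hn'))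
    rw [smul_inv_smul₀ hn'.ne', Nat.cast_smul_eq_nsmul] at this
    exact this.trans (le_posPart u)

theorem bandProj_smul_of_nonneg {r : ℝ} (hr : 0 ≤ r) (x y : E) :
    bandProj x (r • y) = r • bandProj x y := by
  have hge : ∀ {r : ℝ}, 0 ≤ r → ∀ {y : E}, 0 ≤ y → bandProj x (r • y) ≤ r • bandProj x y := by
    intro r hr y hy
    rcases hr.eq_or_lt with rfl | hr'
    · simp [bandProj_of_nonneg, inf_eq_left.2 (nsmul_nonneg (abs_nonneg x) _)]
    refine (isLUB_bandProj x (smul_nonneg hr hy)).2 ?_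
    rintro _ ⟨n, rfl⟩
    obtain ⟨m, hm⟩ := exists_nat_ge ((n : ℝ) / r)
    refine le_trans ?_ (smul_le_smul_left' hr ((isLUB_bandProj x hy).1 ⟨m, rfl⟩))
    simp only
    rw [smul_inf_of_nonneg hr]
    refine inf_le_inf_left _ ?_
    rw [← Nat.cast_smul_eq_nsmul ℝ, ← Nat.cast_smul_eq_nsmul ℝ, smul_smul]
    exact smul_le_smul_of_nonneg_right ((div_le_iff₀' hr').1 hm) (abs_nonneg x)
  have hpos : ∀ {y : E}, 0 ≤ y → bandProj x (r • y) = r • bandProj x y := by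
    intro y hy
    refine le_antisymm (hge hr hy) ?_
    rcases hr.eq_or_lt with rfl | hr'
    · simpa using bandProj_nonneg x (le_refl (0 : E))
    have := hge (inv_nonneg.2 hr) (smul_nonneg hr hy)
    rw [inv_smul_smul₀ hr'.ne'] at this
    have := smul_le_smul_left' hr this
    rwa [smul_inv_smul₀ hr'.ne'] at this
  have hy : y = y⁺ + -y⁻ := by rw [← sub_eq_add_neg, posPart_sub_negPart]
  conv_lhs => rw [hy]
  rw [smul_add, smul_neg, bandProj_add, bandProj_neg, hpos (posPart_nonneg y),
    hpos (negPart_nonneg y), ← smul_neg, ← smul_add, ← bandProj_neg, ← bandProj_add, ← hy]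

/-- The band projection onto the principal band generated by `x`, as a linear map. -/
noncomputable def bandProjₗ (x : E) : E →ₗ[ℝ] E where
  toFun := bandProj x
  map_add' := bandProj_add x
  map_smul' r y := by
    rcases le_total 0 r with hr | hr
    · exact bandProj_smul_of_nonneg hr x y
    · have := bandProj_smul_of_nonneg (neg_nonneg.2 hr) x y
      rw [neg_smul, neg_smul, bandProj_neg, neg_inj] at this
      exact this

@[simp] theorem bandProjₗ_apply (x y : E) : bandProjₗ x y = bandProj x y := rfl

theorem isBandProjection_bandProjₗ (x : E) : IsBandProjection (bandProjₗ x) where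
  idem y := by
    have hy : y = y⁺ - y⁻ := (posPart_sub_negPart y).symm
    rw [hy, map_sub, map_sub]
    simp only [bandProjₗ_apply]
    rw [bandProj_idem_of_nonneg x (posPart_nonneg y), bandProj_idem_of_nonneg x (negPart_nonneg y)]
  nonneg _ hy := bandProj_nonneg x hy
  le_self _ hy := bandProj_le_self x hy

theorem bandProj_abs_self (x : E) : bandProj x |x| = |x| := by
  refine le_antisymm (bandProj_le_self x (abs_nonneg x)) ?_
  have := (isLUB_bandProj x (abs_nonneg x)).1 ⟨1, rfl⟩
  simpa using this

theorem bandProj_eq_zero_of_inf_eq_zero {p q : E} (h : p ⊓ q = 0) : bandProj p q = 0 := by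
  have hp : 0 ≤ p := h ▸ inf_le_left
  have hq : 0 ≤ q := h ▸ inf_le_right
  refine le_antisymm ((isLUB_bandProj p hq).2 ?_) (bandProj_nonneg p hq)
  rintro _ ⟨n, rfl⟩
  rw [abs_of_nonneg hp]
  induction n with
  | zero => simp
  | succ n ih =>
    simp only at ih ⊢
    rw [succ_nsmul, inf_comm]
    refine (inf_add_le (nsmul_nonneg hp n) hp hq).trans ?_
    rw [h, add_zero, inf_comm]
    exact ih

theorem mono_of_nonneg {T : E →ₗ[ℝ] E} (hT : ∀ x, 0 ≤ x → 0 ≤ T x) {x y : E} (h : x ≤ y) :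
    T x ≤ T y := by
  have := hT _ (sub_nonneg.2 h)
  rwa [map_sub, sub_nonneg] at this

namespace IsBandProjection

variable {P Q : E →ₗ[ℝ] E}

theorem mono (hP : IsBandProjection P) {x y : E} (h : x ≤ y) : P x ≤ P y :=
  mono_of_nonneg hP.nonneg h

theorem compl (hP : IsBandProjection P) : IsBandProjection (LinearMap.id - P) where
  idem x := by simp [hP.idem]
  nonneg x hx := by simpa using hP.le_self x hx
  le_self x hx := by simpa using hP.nonneg x hx

theorem id : IsBandProjection (LinearMap.id : E →ₗ[ℝ] E) :=
  ⟨fun _ => rfl, fun _ h => h, fun _ _ => le_rfl⟩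

theorem zero : IsBandProjection (0 : E →ₗ[ℝ] E) :=
  ⟨fun _ => rfl, fun _ _ => le_rfl, fun _ h => h⟩

/-- The remainders of x and y over x ⊓ y are disjoint, and P only shrinks them. -/
theorem map_inf (hP : IsBandProjection P) (x y : E) : P (x ⊓ y) = P x ⊓ P y := by
  have h0 : P (x - x ⊓ y) ⊓ P (y - x ⊓ y) = 0 := by
    refine le_antisymm ?_ (le_inf (hP.nonneg _ (by simp)) (hP.nonneg _ (by simp)))
    refine (inf_le_inf (hP.le_self _ (by simp)) (hP.le_self _ (by simp))).trans ?_
    rw [← inf_sub]; simp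
  rw [map_sub, map_sub, ← inf_sub, sub_eq_zero] at h0
  exact h0.symm

theorem map_sup (hP : IsBandProjection P) (x y : E) : P (x ⊔ y) = P x ⊔ P y := by
  have := hP.map_inf (-x) (-y)
  rw [← neg_sup, map_neg, map_neg, map_neg, ← neg_sup, neg_inj] at this
  exact this

theorem map_posPart (hP : IsBandProjection P) (x : E) : P x⁺ = (P x)⁺ := by
  rw [posPart_def, hP.map_sup, map_zero, posPart_def]

theorem map_abs (hP : IsBandProjection P) (x : E) : P |x| = |P x| := by
  rw [abs, hP.map_sup, map_neg, abs]

/-- The range of a band projection is an ideal. -/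
theorem eq_self_of_le (hP : IsBandProjection P) {y z : E} (hy : 0 ≤ y) (h : y ≤ z)
    (hz : P z = z) : P y = y := by
  refine le_antisymm (hP.le_self y hy) ?_
  have := hP.compl.mono h
  simpa [hz] using this

theorem eq_zero_of_le (hP : IsBandProjection P) {y z : E} (hy : 0 ≤ y) (h : y ≤ z)
    (hz : P z = 0) : P y = 0 :=
  le_antisymm ((hP.mono h).trans hz.le) (hP.nonneg y hy)

theorem ext_nonneg {S T : E →ₗ[ℝ] E} (h : ∀ x, 0 ≤ x → S x = T x) (x : E) : S x = T x := by
  rw [← posPart_sub_negPart x, map_sub, map_sub, h _ (posPart_nonneg x), h _ (negPart_nonneg x)]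

/-- P preserves the ideals that are the ranges of Q and I - Q. So QPQ = PQ and QP(I - Q) = 0. -/
theorem comm (hP : IsBandProjection P) (hQ : IsBandProjection Q) (x : E) :
    P (Q x) = Q (P x) := by
  have key : ∀ {R : E →ₗ[ℝ] E}, IsBandProjection R → ∀ x, R (P (R x)) = P (R x) := by
    intro R hR x
    refine ext_nonneg (S := R ∘ₗ P ∘ₗ R) (T := P ∘ₗ R) (fun x hx => ?_) x
    exact hR.eq_self_of_le (hP.nonneg _ (hR.nonneg _ hx)) (hP.le_self _ (hR.nonneg _ hx))
      (hR.idem x)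
  have h1 := key hQ x
  have h2 := congrArg Q (key hQ.compl x)
  simp only [LinearMap.sub_apply, LinearMap.id_apply, map_sub, hQ.idem] at h2
  rw [← h1]
  rw [sub_self, sub_self, sub_zero] at h2
  exact (sub_eq_zero.1 h2.symm).symm

theorem comp (hP : IsBandProjection P) (hQ : IsBandProjection Q) : IsBandProjection (P ∘ₗ Q) where
  idem x := by
    simp only [LinearMap.comp_apply]
    rw [hP.comm hQ (P (Q x)), hP.idem, hQ.comm hP, hQ.idem]
  nonneg x hx := hP.nonneg _ (hQ.nonneg _ hx)
  le_self x hx := (hP.le_self _ (hQ.nonneg _ hx)).trans (hQ.le_self _ hx)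

theorem isLUB (hP : IsBandProjection P) {ι : Type*} {f : ι → E} {a : E}
    (h : IsLUB (Set.range f) a) : IsLUB (Set.range fun i => P (f i)) (P a) := by
  refine ⟨?_, fun w hw => ?_⟩
  · rintro _ ⟨i, rfl⟩
    exact hP.mono (h.1 ⟨i, rfl⟩)
  · have : a ≤ w + (a - P a) := by
      refine h.2 ?_
      rintro _ ⟨i, rfl⟩
      have h1 := hP.compl.mono (h.1 ⟨i, rfl⟩)
      simp only [LinearMap.sub_apply, LinearMap.id_apply] at h1
      calc f i = P (f i) + (f i - P (f i)) := by abel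
        _ ≤ _ := add_le_add (hw ⟨i, rfl⟩) h1
    have h2 : a - (a - P a) ≤ w := sub_le_iff_le_add.2 this
    simpa using h2

/-- A band projection that annihilates `x` annihilates the band generated by `x`. -/
theorem bandProj_eq_zero (hP : IsBandProjection P) {x : E} (hx : P |x| = 0) (y : E) :
    P (bandProj x y) = 0 := by
  refine ext_nonneg (S := P ∘ₗ bandProjₗ x) (T := 0) (fun y hy => ?_) y
  refine le_antisymm ?_ (hP.nonneg _ (bandProj_nonneg x hy))
  refine (hP.isLUB (isLUB_bandProj x hy)).2 ?_
  rintro _ ⟨n, rfl⟩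
  refine (hP.mono inf_le_right).trans ?_
  simp [map_nsmul, hx]

/-- Turns the product p ⊓ q of components of e into a composition of projections applied to e. -/
theorem inf_apply (hP : IsBandProjection P) (hQ : IsBandProjection Q) {x : E} (hx : 0 ≤ x) :
    P x ⊓ Q x = P (Q x) := by
  refine le_antisymm ?_ (le_inf (hP.mono (hQ.le_self x hx)) ?_)
  · have h0 : 0 ≤ P x ⊓ Q x := le_inf (hP.nonneg _ hx) (hQ.nonneg _ hx)
    rw [← hP.eq_self_of_le h0 inf_le_left (hP.idem x)]
    exact hP.mono inf_le_right
  · rw [hP.comm hQ]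
    exact hQ.mono (hP.le_self x hx)

theorem inf_compl (hP : IsBandProjection P) {x : E} (hx : 0 ≤ x) : P x ⊓ (x - P x) = 0 := by
  have := hP.inf_apply hP.compl hx
  simpa [hP.idem] using this

end IsBandProjection

/-- Components of `x ≥ 0` are the values at `x` of band projections. -/
theorem exists_bandProjection_of_component {x p : E} (h : p ⊓ (x - p) = 0) :
    ∃ P : E →ₗ[ℝ] E, IsBandProjection P ∧ P x = p := by
  have hp : 0 ≤ p := h ▸ inf_le_left
  refine ⟨bandProjₗ p, isBandProjection_bandProjₗ p, ?_⟩
  have h1 : bandProj p p = p := by simpa [abs_of_nonneg hp] using bandProj_abs_self p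
  have h2 := bandProj_eq_zero_of_inf_eq_zero h
  have : x = p + (x - p) := by abel
  rw [bandProjₗ_apply]
  conv_lhs => rw [this, bandProj_add, h1, h2, add_zero]

end Module

/-! ### Partitions of e into levels of an element; naturality of sums. -/

section Partition

variable {E : Type*} [ConditionallyCompleteLattice E] [AddCommGroup E] [IsOrderedAddMonoid E]
  [Module ℝ E] [IsOrderedModule ℝ E]

namespace IsBandProjection

variable {P Q R : E →ₗ[ℝ] E}

theorem add_of_disjoint (hP : IsBandProjection P) (hQ : IsBandProjection Q)
    (h : ∀ x, P (Q x) = 0) : IsBandProjection (P + Q) := by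
  have h' : ∀ x, Q (P x) = 0 := fun x => by rw [hQ.comm hP, h]
  have : P + Q = LinearMap.id - (LinearMap.id - P) ∘ₗ (LinearMap.id - Q) := by
    ext x
    simp only [LinearMap.add_apply, LinearMap.sub_apply, LinearMap.id_apply,
      LinearMap.comp_apply, map_sub, h]
    abel
  rw [this]
  exact (hP.compl.comp hQ.compl).compl

theorem sum_of_disjoint {ι : Type*} {N : ι → E →ₗ[ℝ] E} (hN : ∀ i, IsBandProjection (N i))
    (s : Finset ι) (hd : ∀ i ∈ s, ∀ j ∈ s, i ≠ j → ∀ x, N i (N j x) = 0) :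
    IsBandProjection (∑ i ∈ s, N i) := by
  classical
  induction s using Finset.induction_on with
  | empty => simpa using IsBandProjection.zero
  | insert a s ha ih =>
    rw [Finset.sum_insert ha]
    refine (hN a).add_of_disjoint (ih fun i hi j hj => hd i (by simp [hi]) j (by simp [hj]))
      fun x => ?_
    rw [LinearMap.sum_apply, map_sum]
    refine Finset.sum_eq_zero fun j hj => hd a (by simp) j (by simp [hj]) ?_ x
    rintro rfl
    exact ha hj

/-- A band projection that annihilates a weak order unit is zero. -/
theorem eq_zero_of_unit {e : E} (hw : ∀ x : E, |x| ⊓ e = 0 → x = 0) (hR : IsBandProjection R)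
    (he : 0 ≤ e) (h : R e = 0) (y : E) : R y = 0 := by
  refine ext_nonneg (S := R) (T := 0) (fun y hy => ?_) y
  have hy' := hR.nonneg y hy
  refine hw _ ?_
  rw [abs_of_nonneg hy']
  have h1 := hR.eq_self_of_le (le_inf hy' he) inf_le_left (hR.idem y)
  rw [← h1, hR.map_inf, h, hR.idem]
  exact inf_eq_right.2 hy'

end IsBandProjection

/-- A sequence of pairwise disjoint band projections with sum `I`. -/
structure IsPartition (e : E) (N : ℕ → E →ₗ[ℝ] E) : Prop where
  proj : ∀ k, IsBandProjection (N k)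
  disj : ∀ j k, j ≠ k → ∀ x, N j (N k x) = 0
  sup : IsLUB (Set.range fun n : ℕ => ∑ k ∈ Finset.range n, N k e) e

/-- A partition such that `x` equals `k e` on the `k`-th piece. -/
structure IsLevels (e x : E) (N : ℕ → E →ₗ[ℝ] E) : Prop extends IsPartition e N where
  level : ∀ k : ℕ, N k x = (k : ℝ) • N k e

namespace IsPartition

variable {e : E} {N : ℕ → E →ₗ[ℝ] E}

theorem apply_apply (h : IsPartition e N) (j k : ℕ) (x : E) :
    N j (N k x) = if j = k then N j x else 0 := by
  split_ifs with hjk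
  · rw [hjk, (h.proj k).idem]
  · exact h.disj j k hjk x

theorem proj_sum (h : IsPartition e N) (n : ℕ) : IsBandProjection (∑ k ∈ Finset.range n, N k) :=
  IsBandProjection.sum_of_disjoint h.proj _ fun i _ j _ hij => h.disj i j hij

theorem le_of_forall_le (h : IsPartition e N) (he : 0 ≤ e) (hw : ∀ x : E, |x| ⊓ e = 0 → x = 0)
    {y z : E} (hyz : ∀ k, N k y ≤ N k z) : y ≤ z := by
  have h0 : (y - z)⁺ = 0 := by
    set v := (y - z)⁺ with hv
    have hv0 : 0 ≤ v := posPart_nonneg _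
    have hNv : ∀ k, N k v = 0 := fun k => by
      rw [hv, (h.proj k).map_posPart, map_sub, posPart_eq_zero, sub_nonpos]
      exact hyz k
    refine hw v ?_
    rw [abs_of_nonneg hv0]
    have hu0 : 0 ≤ v ⊓ e := le_inf hv0 he
    refine le_antisymm ?_ hu0
    -- Each partial sum projection kills v ⊓ e, hence its value at e stays below e - v ⊓ e.
    have : e ≤ e - v ⊓ e := by
      refine h.sup.2 ?_
      rintro _ ⟨n, rfl⟩
      have hP := h.proj_sum n
      have h1 : (∑ k ∈ Finset.range n, N k) (v ⊓ e) = 0 := by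
        refine hP.eq_zero_of_le hu0 inf_le_left ?_
        simp [LinearMap.sum_apply, hNv]
      have h2 := hP.compl.mono (inf_le_right : v ⊓ e ≤ e)
      simp only [LinearMap.sub_apply, LinearMap.id_apply, h1, sub_zero,
        LinearMap.sum_apply] at h2
      exact le_sub_comm.1 h2
    simpa using this
  exact sub_nonpos.1 (posPart_eq_zero.1 h0)

theorem eq_of_forall_eq (h : IsPartition e N) (he : 0 ≤ e) (hw : ∀ x : E, |x| ⊓ e = 0 → x = 0)
    {y z : E} (hyz : ∀ k, N k y = N k z) : y = z :=
  le_antisymm (h.le_of_forall_le he hw fun k => (hyz k).le)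
    (h.le_of_forall_le he hw fun k => (hyz k).ge)

end IsPartition

/-! ### Level projections -/

/-- The band projection `P_{x = te}`. -/
noncomputable def levelProj (e x : E) (t : ℝ) : E →ₗ[ℝ] E :=
  LinearMap.id - bandProjₗ |x - t • e|

theorem isBandProjection_levelProj (e x : E) (t : ℝ) : IsBandProjection (levelProj e x t) :=
  (isBandProjection_bandProjₗ _).compl

theorem massFun_eq (e : E) (T : E →ₗ[ℝ] E) (x : E) (t : ℝ) :
    massFun e T x t = T (levelProj e x t e) := rfl

theorem eq_zero_of_abs {x : E} (h : |x| = 0) : x = 0 :=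
  le_antisymm (h ▸ le_abs_self x) (neg_nonpos.1 (h ▸ neg_le_abs x))

theorem levelProj_self (e x : E) (t : ℝ) : levelProj e x t x = t • levelProj e x t e := by
  have h : levelProj e x t |x - t • e| = 0 := by
    have := bandProj_abs_self |x - t • e|
    rw [abs_abs] at this
    simp [levelProj, this]
  rw [(isBandProjection_levelProj e x t).map_abs] at h
  have h' := eq_zero_of_abs h
  rwa [map_sub, map_smul, sub_eq_zero] at h'

/-- Maximality of P_{x=te} among the band projections on which x agrees with te. -/
theorem comp_levelProj {e x : E} {t : ℝ} {R : E →ₗ[ℝ] E} (hR : IsBandProjection R)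
    (h : R x = t • R e) (y : E) : R (levelProj e x t y) = R y := by
  have : R |(|x - t • e|)| = 0 := by
    rw [abs_abs, hR.map_abs, map_sub, map_smul, h, sub_self, abs_zero]
  simp [levelProj, hR.bandProj_eq_zero this]

/-- On the common part x equals both se and te, so e vanishes there, and e is a weak unit. -/
theorem levelProj_disjoint {e : E} (he : 0 ≤ e) (hw : ∀ x : E, |x| ⊓ e = 0 → x = 0) (x : E)
    {s t : ℝ} (hst : s ≠ t) (y : E) : levelProj e x s (levelProj e x t y) = 0 := by
  have hs := isBandProjection_levelProj e x s
  have ht := isBandProjection_levelProj e x t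
  refine (hs.comp ht).eq_zero_of_unit hw he ?_ y
  have h1 := congrArg (levelProj e x t) (levelProj_self e x s)
  have h2 := congrArg (levelProj e x s) (levelProj_self e x t)
  rw [hs.comm ht, h1, map_smul, map_smul, hs.comm ht, ← sub_eq_zero, ← sub_smul] at h2
  rw [LinearMap.comp_apply, hs.comm ht]
  exact (smul_eq_zero.1 h2).resolve_left (sub_ne_zero.2 hst)

namespace IsConditionalTriple

variable {e : E} {T : E →ₗ[ℝ] E}

theorem mono (hT : IsConditionalTriple e T) {x y : E} (h : x ≤ y) : T x ≤ T y :=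
  mono_of_nonneg hT.nonneg h

theorem isLUB (hT : IsConditionalTriple e T) {f : ℕ → E} (hf : Monotone f) {a : E}
    (h : IsLUB (Set.range f) a) : IsLUB (Set.range fun n => T (f n)) (T a) := by
  have h1 : IsGLB (Set.range fun n => a - f n) 0 := by
    refine ⟨?_, fun w hw => ?_⟩
    · rintro _ ⟨n, rfl⟩
      exact sub_nonneg.2 (h.1 ⟨n, rfl⟩)
    · have : a ≤ a - w := h.2 (by rintro _ ⟨n, rfl⟩; exact le_sub_comm.1 (hw ⟨n, rfl⟩))
      simpa using this
  have h2 := hT.order_cont _ (Set.range_nonempty _) ?_ h1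
  · refine ⟨?_, fun w hw => ?_⟩
    · rintro _ ⟨n, rfl⟩
      exact hT.mono (h.1 ⟨n, rfl⟩)
    · have : T a - w ≤ 0 := by
        refine h2.2 ?_
        rintro _ ⟨_, ⟨n, rfl⟩, rfl⟩
        rw [map_sub]
        exact sub_le_sub_left (hw ⟨n, rfl⟩) _
      exact sub_nonpos.1 this
  · rintro _ ⟨m, rfl⟩ _ ⟨n, rfl⟩
    exact ⟨_, ⟨max m n, rfl⟩, sub_le_sub_left (hf (le_max_left m n)) _,
      sub_le_sub_left (hf (le_max_right m n)) _⟩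

end IsConditionalTriple

theorem monotone_sum_range {f : ℕ → E} (hf : ∀ k, 0 ≤ f k) :
    Monotone fun n : ℕ => ∑ k ∈ Finset.range n, f k :=
  monotone_nat_of_le_succ fun n => by
    rw [Finset.sum_range_succ]
    exact le_add_of_nonneg_right (hf n)

/-- If w bounds the partial sums of the P_{x=k}e, then T(e - w ⊓ e) ≤ 0 by naturality, and strict
positivity of T yields e ≤ w. -/
theorem IsNatural.isLevels {e : E} {T : E →ₗ[ℝ] E} (hT : IsConditionalTriple e T) {x : E}
    (hx : IsNatural e T x) : IsLevels e x fun k => levelProj e x (k : ℝ) where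
  proj k := isBandProjection_levelProj _ _ _
  disj j k hjk y := levelProj_disjoint hT.unit_nonneg hT.unit_weak x (by exact_mod_cast hjk) y
  level k := levelProj_self _ _ _
  sup := by
    have hproj : ∀ n : ℕ, IsBandProjection (∑ k ∈ Finset.range n, levelProj e x (k : ℝ)) :=
      fun n => IsBandProjection.sum_of_disjoint (fun k => isBandProjection_levelProj _ _ _) _
        fun i _ j _ hij => levelProj_disjoint hT.unit_nonneg hT.unit_weak x (by exact_mod_cast hij)
    have hle : ∀ n : ℕ, ∑ k ∈ Finset.range n, levelProj e x (k : ℝ) e ≤ e := fun n => by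
      have := (hproj n).le_self e hT.unit_nonneg
      rwa [LinearMap.sum_apply] at this
    refine ⟨?_, fun w hw => ?_⟩
    · rintro _ ⟨n, rfl⟩
      exact hle n
    · have h0 : 0 ≤ e - w ⊓ e := sub_nonneg.2 inf_le_right
      have h1 : e ≤ e - T (e - w ⊓ e) := by
        refine hx.2 ?_
        rintro _ ⟨n, rfl⟩
        have : T (e - w ⊓ e) ≤ T (e - ∑ k ∈ Finset.range n, levelProj e x (k : ℝ) e) :=
          hT.mono (sub_le_sub_left (le_inf (hw ⟨n, rfl⟩) (hle n)) _)
        rw [map_sub T e (∑ k ∈ _, _), hT.map_unit, map_sum] at this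
        exact le_sub_comm.1 this
      have h2 : T (e - w ⊓ e) ≤ 0 := by simpa using h1
      rcases h0.eq_or_lt with h3 | h3
      · rw [eq_comm, sub_eq_zero] at h3
        exact h3.le.trans inf_le_left
      · exact absurd (hT.strictly_pos _ h3) (not_lt_of_ge h2)

/-- Each R k lies under P_{x=k} by maximality, and the R k already exhaust e, leaving no room for
more. -/
theorem IsLevels.levelProj_eq {e x : E} {R : ℕ → E →ₗ[ℝ] E} (h : IsLevels e x R) (he : 0 ≤ e)
    (hw : ∀ x : E, |x| ⊓ e = 0 → x = 0) (k : ℕ) (y : E) : levelProj e x (k : ℝ) y = R k y := by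
  have hN := fun t : ℝ => isBandProjection_levelProj e x t
  have hR : ∀ j : ℕ, ∀ y, R j (levelProj e x (j : ℝ) y) = R j y := fun j =>
    comp_levelProj (h.proj j) (h.level j)
  refine h.eq_of_forall_eq he hw fun j => ?_
  rw [h.apply_apply]
  split_ifs with hjk
  · subst hjk
    exact hR j y
  · rw [← hR j, levelProj_disjoint he hw x (by exact_mod_cast hjk), map_zero]

theorem IsLevels.isNatural {e x : E} {T : E →ₗ[ℝ] E} (hT : IsConditionalTriple e T)
    {R : ℕ → E →ₗ[ℝ] E} (h : IsLevels e x R) : IsNatural e T x := by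
  have := hT.isLUB (monotone_sum_range fun k => (h.proj k).nonneg e hT.unit_nonneg) h.sup
  rw [hT.map_unit] at this
  unfold IsNatural
  simpa only [massFun_eq, h.levelProj_eq hT.unit_nonneg hT.unit_weak, map_sum] using this

/-! ### Sums over triangles and squares -/

theorem sum_triangle (f : ℕ → ℕ → E) (n : ℕ) :
    ∑ l ∈ Finset.range n, ∑ p ∈ Finset.HasAntidiagonal.antidiagonal l, f p.1 p.2 =
      ∑ p ∈ (Finset.range n ×ˢ Finset.range n).filter (fun p => p.1 + p.2 < n), f p.1 p.2 := by
  rw [← Finset.sum_fiberwise_of_maps_to (g := fun p : ℕ × ℕ => p.1 + p.2) (t := Finset.range n)]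
  · refine Finset.sum_congr rfl fun l hl => Finset.sum_congr ?_ fun _ _ => rfl
    ext ⟨a, b⟩
    simp only [Finset.HasAntidiagonal.mem_antidiagonal, Finset.mem_filter, Finset.mem_product, Finset.mem_range]
      at hl ⊢
    omega
  · intro p hp
    simp only [Finset.mem_filter] at hp
    simpa using hp.2

theorem sum_triangle_le_sum_square {f : ℕ → ℕ → E} (hf : ∀ k m, 0 ≤ f k m) (n : ℕ) :
    ∑ l ∈ Finset.range n, ∑ p ∈ Finset.HasAntidiagonal.antidiagonal l, f p.1 p.2 ≤
      ∑ k ∈ Finset.range n, ∑ m ∈ Finset.range n, f k m := by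
  rw [sum_triangle, ← Finset.sum_product' (Finset.range n) (Finset.range n) f]
  exact Finset.sum_le_sum_of_subset_of_nonneg (Finset.filter_subset _ _) fun _ _ _ => hf _ _

theorem sum_rectangle_le_sum_triangle {f : ℕ → ℕ → E} (hf : ∀ k m, 0 ≤ f k m) (a b : ℕ) :
    ∑ k ∈ Finset.range a, ∑ m ∈ Finset.range b, f k m ≤
      ∑ l ∈ Finset.range (a + b), ∑ p ∈ Finset.HasAntidiagonal.antidiagonal l, f p.1 p.2 := by
  rw [sum_triangle, ← Finset.sum_product' (Finset.range a) (Finset.range b) f]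
  refine Finset.sum_le_sum_of_subset_of_nonneg ?_ fun _ _ _ => hf _ _
  rintro ⟨i, j⟩
  simp only [Finset.mem_filter, Finset.mem_product, Finset.mem_range]
  omega

/-! ### The levels of a sum -/

/-- The pieces of the partition generated by `N` and `M` on which the indices sum to `l`. -/
def convPartition (N M : ℕ → E →ₗ[ℝ] E) (l : ℕ) : E →ₗ[ℝ] E :=
  ∑ p ∈ Finset.HasAntidiagonal.antidiagonal l, N p.1 ∘ₗ M p.2

theorem convPartition_apply (N M : ℕ → E →ₗ[ℝ] E) (l : ℕ) (y : E) :
    convPartition N M l y = ∑ p ∈ Finset.HasAntidiagonal.antidiagonal l, N p.1 (M p.2 y) := by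
  simp [convPartition, LinearMap.sum_apply]

theorem IsLevels.add {e x y : E} (he : 0 ≤ e) {N M : ℕ → E →ₗ[ℝ] E} (hN : IsLevels e x N)
    (hM : IsLevels e y M) : IsLevels e (x + y) (convPartition N M) := by
  have hc : ∀ p : ℕ × ℕ, IsBandProjection (N p.1 ∘ₗ M p.2) := fun p =>
    (hN.proj _).comp (hM.proj _)
  have hd : ∀ p q : ℕ × ℕ, p ≠ q → ∀ z, (N p.1 ∘ₗ M p.2) ((N q.1 ∘ₗ M q.2) z) = 0 := by
    rintro ⟨a, b⟩ ⟨c, d⟩ hpq z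
    simp only [LinearMap.comp_apply]
    rw [(hM.proj b).comm (hN.proj c), hN.apply_apply, hM.apply_apply]
    split_ifs with h1 h2
    · exact absurd (by rw [h1, h2]) hpq
    · simp
    · rfl
  have hsum : ∀ l, IsBandProjection (convPartition N M l) := fun l =>
    IsBandProjection.sum_of_disjoint hc _ fun p _ q _ hpq => hd p q hpq
  refine ⟨⟨hsum, ?_, ?_, ?_⟩, ?_⟩
  · intro j k hjk z
    rw [convPartition_apply N M k, map_sum]
    refine Finset.sum_eq_zero fun q hq => ?_
    rw [convPartition_apply]
    refine Finset.sum_eq_zero fun p hp => hd p q ?_ z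
    rintro rfl
    simp only [Finset.HasAntidiagonal.mem_antidiagonal] at hp hq
    exact hjk (hp.symm.trans hq)
  · rintro _ ⟨n, rfl⟩
    have := (IsBandProjection.sum_of_disjoint hsum (Finset.range n) ?_).le_self e he
    · rwa [LinearMap.sum_apply] at this
    · intro j _ k _ hjk z
      rw [convPartition_apply N M k, map_sum]
      refine Finset.sum_eq_zero fun q hq => ?_
      rw [convPartition_apply]
      refine Finset.sum_eq_zero fun p hp => hd p q ?_ z
      rintro rfl
      simp only [Finset.HasAntidiagonal.mem_antidiagonal] at hp hq
      exact hjk (hp.symm.trans hq)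
  · intro w hw
    -- Rectangles fit into triangles. The supremum is then taken over b, by order continuity of a
    -- band projection, and after that over a.
    have h1 : ∀ a b : ℕ, (∑ k ∈ Finset.range a, N k) (∑ m ∈ Finset.range b, M m e) ≤ w := by
      intro a b
      refine le_trans ?_ (hw ⟨a + b, rfl⟩)
      simp only [convPartition_apply, LinearMap.sum_apply, map_sum]
      refine le_trans (le_of_eq ?_) (sum_rectangle_le_sum_triangle (fun k m =>
        (hN.proj k).nonneg _ ((hM.proj m).nonneg e he)) a b)
      exact Finset.sum_comm
    refine hN.sup.2 ?_
    rintro _ ⟨a, rfl⟩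
    have h2 := (hN.proj_sum a).isLUB hM.sup
    simp only [← LinearMap.sum_apply] at h2 ⊢
    refine h2.2 ?_
    rintro _ ⟨b, rfl⟩
    simpa only [LinearMap.sum_apply] using h1 a b
  · intro l
    rw [convPartition_apply, convPartition_apply, Finset.smul_sum]
    refine Finset.sum_congr rfl fun p hp => ?_
    rw [map_add, map_add, hM.level, map_smul, (hN.proj p.1).comm (hM.proj p.2) x, hN.level,
      map_smul, (hM.proj p.2).comm (hN.proj p.1), ← add_smul, ← Finset.HasAntidiagonal.mem_antidiagonal.1 hp]
    push_cast
    rfl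

end Partition

/-! ### Suprema in the sup-completion. -/

namespace SupCompletion

variable {E : Type*} [Preorder E]

theorem subset_supOf (S : Set E) (hS : S.Nonempty) : S ⊆ (supOf S hS).carrier :=
  fun _ hx _ hA => hA hx

theorem supOf_le {S : Set E} {hS : S.Nonempty} {A : SupCompletion E} (h : S ⊆ A.carrier) :
    supOf S hS ≤ A :=
  fun _ hy => hy A h

theorem supOf_eq_of {S : Set E} {hS : S.Nonempty} {u : E} (h : IsLUB S u) : supOf S hS = of u :=
  le_antisymm (supOf_le h.1) ((of_le_iff _ _).2
    ((supOf S hS).lub_mem' S (subset_supOf S hS) hS u h))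

theorem mem_of_isLUB (A : SupCompletion E) {ι : Type*} [Nonempty ι] {f : ι → E} {a : E}
    (h : IsLUB (Set.range f) a) (hf : ∀ i, f i ∈ A.carrier) : a ∈ A.carrier :=
  A.lub_mem' _ (Set.range_subset_iff.2 hf) (Set.range_nonempty f) a h

end SupCompletion

/-! ### Daniell integrals evaluated on levels; uniqueness of the functional value. -/

section FunctionalCalculus

variable {E : Type*} [ConditionallyCompleteLattice E] [AddCommGroup E] [IsOrderedAddMonoid E]
  [Module ℝ E] [IsOrderedModule ℝ E]

/-- The set on the right is itself an element of E^s, by infinite distributivity, and contains every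
f n. -/
theorem mem_supOf_range_iff (f : ℕ → E) (y : E) :
    y ∈ (supOf (Set.range f) (Set.range_nonempty f)).carrier ↔
      IsLUB (Set.range fun n => y ⊓ f n) y := by
  refine ⟨fun hy => ?_, fun hy => mem_of_isLUB _ hy fun n =>
    (supOf _ _).lower' inf_le_right (subset_supOf _ _ ⟨n, rfl⟩)⟩
  let A : SupCompletion E :=
    { carrier := {y | IsLUB (Set.range fun n => y ⊓ f n) y}
      nonempty' := ⟨f 0, by
        rintro _ ⟨n, rfl⟩
        exact inf_le_left, fun w hw => by
        have := hw ⟨0, rfl⟩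
        simpa using this⟩
      lower' := by
        intro a b hba ha
        have := isLUB_inf_left ha b
        simp only [inf_eq_left.2 hba, ← inf_assoc] at this
        exact this
      lub_mem' := by
        intro B hB _ b hb
        refine ⟨by rintro _ ⟨n, rfl⟩; exact inf_le_left, fun w hw => hb.2 fun c hc => ?_⟩
        refine (hB hc).2 ?_
        rintro _ ⟨n, rfl⟩
        exact (inf_le_inf_right _ (hb.1 hc)).trans (hw ⟨n, rfl⟩) }
  refine hy A ?_
  rintro _ ⟨m, rfl⟩
  refine ⟨by rintro _ ⟨n, rfl⟩; exact inf_le_left, fun w hw => ?_⟩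
  have := hw ⟨m, rfl⟩
  simpa using this

theorem isLUB_smul_of_nonneg {γ : ℝ} {f : ℕ → ℝ} (h : IsLUB (Set.range f) γ) {u : E}
    (hu : 0 ≤ u) : IsLUB (Set.range fun n => f n • u) (γ • u) := by
  refine ⟨?_, fun w hw => ?_⟩
  · rintro _ ⟨n, rfl⟩
    exact smul_le_smul_of_nonneg_right (h.1 ⟨n, rfl⟩) hu
  · refine sub_nonpos.1 (nonpos_of_forall_le_smul (u := u) fun δ hδ => ?_)
    obtain ⟨_, ⟨n, rfl⟩, hn, _⟩ := h.exists_between (sub_lt_self γ hδ)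
    have h1 : γ • u - δ • u ≤ w := by
      rw [← sub_smul]
      exact (smul_le_smul_of_nonneg_right hn.le hu).trans (hw ⟨n, rfl⟩)
    exact sub_le_comm.1 h1

namespace IsLevels

variable {e x : E} {N : ℕ → E →ₗ[ℝ] E}

/-- On the k-th piece x - re = (k - r)e, whose positive part generates nothing if k ≤ r and the
whole piece if k > r. -/
theorem apply_spectral (h : IsLevels e x N) (k : ℕ) (t : EReal) :
    N k (spectral e x t) = (if ((k : ℝ) : EReal) ≤ t then (1 : ℝ) else 0) • N k e := by
  have hN := h.proj k
  induction t using EReal.rec with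
  | bot =>
    have : ¬ ((k : ℝ) : EReal) ≤ ⊥ := by
      rw [le_bot_iff]
      exact EReal.coe_ne_bot _
    simp only [spectral, if_true, map_zero, if_neg this, zero_smul]
  | top => simp [spectral]
  | coe r =>
    have h1 : N k (x - r • e) = ((k : ℝ) - r) • N k e := by
      rw [map_sub, map_smul, h.level, sub_smul]
    simp only [spectral, EReal.coe_ne_bot, EReal.coe_ne_top, if_false, EReal.toReal_coe,
      EReal.coe_le_coe_iff]
    split_ifs with hk
    · have h2 : N k |(x - r • e)⁺| = 0 ∨ ¬ 0 ≤ N k e := by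
        by_cases h0 : 0 ≤ N k e
        · left
          rw [abs_of_nonneg (posPart_nonneg _), hN.map_posPart, h1, posPart_eq_zero]
          exact smul_nonpos_of_nonpos_of_nonneg (sub_nonpos.2 hk) h0
        · exact Or.inr h0
      have h0 : 0 ≤ N k e := by
        refine hN.nonneg e ?_
        have := h.sup.1 ⟨0, rfl⟩
        simpa using this
      rw [map_sub, hN.bandProj_eq_zero (h2.resolve_right (not_not.2 h0)), sub_zero, one_smul]
    · have he : 0 ≤ e := by
        have := h.sup.1 ⟨0, rfl⟩
        simpa using this
      have hlt : 0 < (k : ℝ) - r := sub_pos.2 (not_le.1 hk)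
      have hB := isBandProjection_bandProjₗ (x - r • e)⁺
      have h2 : N k (x - r • e)⁺ = ((k : ℝ) - r) • N k e := by
        rw [hN.map_posPart, h1, posPart_eq_self]
        exact smul_nonneg hlt.le (hN.nonneg e he)
      have h3 : bandProjₗ (x - r • e)⁺ (x - r • e)⁺ = (x - r • e)⁺ := by
        have := bandProj_abs_self (x - r • e)⁺
        rwa [abs_of_nonneg (posPart_nonneg _)] at this
      have h4 := congrArg (N k) h3
      rw [hN.comm hB, h2, map_smul] at h4
      have h5 := smul_right_injective E hlt.ne' h4
      rw [hB.comm hN] at h5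
      rw [map_sub, zero_smul, sub_eq_zero]
      exact h5.symm

theorem apply_integral (h : IsLevels e x N) (k : ℕ) (φ : Step) :
    N k (φ.integral e x) = φ.eval (k : ℝ) • N k e := by
  unfold Step.integral Step.eval
  rw [Finsupp.sum, Finsupp.sum, map_sum, Finset.sum_smul]
  refine Finset.sum_congr rfl fun J _ => ?_
  rw [map_smul, map_sub, h.apply_spectral, h.apply_spectral, ← sub_smul, smul_smul]
  congr 1
  simp only [Set.indicator, Set.mem_ofPred_eq, le_max_iff]
  generalize ((k : ℝ) : EReal) = κ
  -- If κ ≤ J.1, both spectral values are the whole piece and cancel. Otherwise the maximum reduces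
  -- to J.2.
  by_cases h1 : κ ≤ J.1
  · simp [h1, not_lt.2 h1]
  · simp only [h1, false_or, not_le.1 h1, true_and, if_false, sub_zero]
    split_ifs <;> simp

variable (he : 0 ≤ e) (hw : ∀ x : E, |x| ⊓ e = 0 → x = 0)

include he hw

/-- An integral is determined by the values of the integrand at the levels. -/
theorem carrier_of_hasUpIntegral (h : IsLevels e x N) {g : ℝ → EReal} {G : SupCompletion E}
    (hG : HasUpIntegral e x g G) {γ : ℕ → ℝ} (hγ : ∀ k : ℕ, g k = (γ k : EReal)) :
    G.carrier = {y | ∀ k, N k y ≤ γ k • N k e} := by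
  obtain ⟨φ, hmono, hsup, rfl⟩ := hG
  have hlub : ∀ k : ℕ, IsLUB (Set.range fun n => (φ n).eval k) (γ k) := fun k => by
    have h1 := hsup k
    rw [hγ] at h1
    refine ⟨?_, fun w hw => ?_⟩
    · rintro _ ⟨n, rfl⟩
      exact EReal.coe_le_coe_iff.1 (h1.1 ⟨n, rfl⟩)
    · refine EReal.coe_le_coe_iff.1 (h1.2 ?_)
      rintro _ ⟨n, rfl⟩
      exact EReal.coe_le_coe_iff.2 (hw ⟨n, rfl⟩)
  have hNe : ∀ k, 0 ≤ N k e := fun k => (h.proj k).nonneg e he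
  ext y
  constructor
  · intro hy
    refine hy ⟨{y | ∀ k, N k y ≤ γ k • N k e}, ?_, ?_, ?_⟩ ?_
    · refine ⟨(φ 0).integral e x, fun k => ?_⟩
      rw [h.apply_integral]
      exact smul_le_smul_of_nonneg_right ((hlub k).1 ⟨0, rfl⟩) (hNe k)
    · exact fun a b hba ha k => ((h.proj k).mono hba).trans (ha k)
    · intro B hB _ b hb k
      have hb' : IsLUB (Set.range ((↑) : B → E)) b := by rwa [Subtype.range_coe]
      refine ((h.proj k).isLUB hb').2 ?_
      rintro _ ⟨⟨c, hc⟩, rfl⟩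
      exact hB hc k
    · rintro _ ⟨n, rfl⟩ k
      rw [h.apply_integral]
      exact smul_le_smul_of_nonneg_right ((hlub k).1 ⟨n, rfl⟩) (hNe k)
  · intro hy
    refine mem_of_isLUB (f := fun n => y ⊓ (φ n).integral e x) _ ⟨?_, fun w hw' => ?_⟩
      fun n => (supOf _ _).lower' inf_le_right (subset_supOf _ _ ⟨n, rfl⟩)
    · rintro _ ⟨n, rfl⟩
      exact inf_le_left
    · refine h.le_of_forall_le he hw fun k => ?_
      have h1 := isLUB_inf_left (isLUB_smul_of_nonneg (hlub k) (hNe k)) (N k y)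
      rw [inf_eq_left.2 (hy k)] at h1
      refine h1.2 ?_
      rintro _ ⟨n, rfl⟩
      have := (h.proj k).mono (hw' ⟨n, rfl⟩)
      rwa [(h.proj k).map_inf, h.apply_integral] at this

theorem apply_of_hasUpIntegralIn (h : IsLevels e x N) {f : ℝ → ℝ} {u : E}
    (hu : HasUpIntegralIn e x f u) (k : ℕ) : N k u = f k • N k e := by
  have h1 := h.carrier_of_hasUpIntegral he hw hu.2 (γ := fun k => f k) fun _ => rfl
  have h2 : ∀ y, y ≤ u ↔ ∀ k : ℕ, N k y ≤ f k • N k e := fun y => by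
    have : y ∈ (of u).carrier ↔ y ∈ {y | ∀ k : ℕ, N k y ≤ f k • N k e} := by rw [h1]
    exact this
  have h3 := (h2 u).1 le_rfl
  refine le_antisymm (h3 k) ?_
  -- Raising u by its defect on the k-th piece keeps all constraints satisfied, so the defect is
  -- zero.
  have h4 : u + (f k • N k e - N k u) ≤ u := by
    refine (h2 _).2 fun j => ?_
    rw [map_add, map_sub, map_smul, h.apply_apply, h.apply_apply]
    split_ifs with hjk
    · subst hjk
      exact (add_sub_cancel _ _).le
    · simpa using h3 j
  have h5 := sub_nonpos.1 (add_le_iff_nonpos_right u |>.1 h4)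
  exact h5

/-- The right side does not involve the decomposition f = g - (h₁ - h₂), which gives uniqueness.
Since f is real-valued, g must be finite at each k. -/
theorem carrier_of_hasFunctionalValue (h : IsLevels e x N) {f : ℝ → ℝ} {A : SupCompletion E}
    (hA : HasFunctionalValue e x (fun t => (f t : EReal)) A) :
    A.carrier = {y | ∀ k : ℕ, N k y ≤ f k • N k e} := by
  obtain ⟨g, h₁, h₂, G, u₁, u₂, hG, hu₁, hu₂, hf, rfl⟩ := hA
  have hg : ∀ k : ℕ, g k = ((f k + (h₁ k - h₂ k) : ℝ) : EReal) := fun k => by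
    have h1 : (f k : EReal) = g k - ((h₁ k - h₂ k : ℝ) : EReal) := hf k
    revert h1
    generalize g k = z
    induction z using EReal.rec with
    | bot =>
      intro h1
      rw [EReal.bot_sub] at h1
      exact absurd h1 (EReal.coe_ne_bot _)
    | top =>
      intro h1
      rw [EReal.top_sub_coe] at h1
      exact absurd h1 (EReal.coe_ne_top _)
    | coe r =>
      intro h1
      have : f k = r - (h₁ k - h₂ k) := by exact_mod_cast h1
      rw [this, sub_add_cancel]
  have h1 := h.carrier_of_hasUpIntegral he hw hG hg
  ext y
  change y - -(u₁ - u₂) ∈ G.carrier ↔ _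
  rw [h1]
  simp only [Set.mem_ofPred_eq]
  refine forall_congr' fun k => ?_
  rw [sub_neg_eq_add, map_add, map_sub, h.apply_of_hasUpIntegralIn he hw hu₁,
    h.apply_of_hasUpIntegralIn he hw hu₂, ← sub_smul, add_smul, add_le_add_iff_right]

/-- The generating function is the conditional expectation of the functional value. -/
theorem genFun_eq_extend {T : E →ₗ[ℝ] E} (hT : IsConditionalTriple e T) (h : IsLevels e x N)
    {s : ℝ} (hs : 0 ≤ s) {A : SupCompletion E}
    (hA : A.carrier = {y | ∀ k : ℕ, N k y ≤ s ^ k • N k e}) :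
    genFun e T x s = extend T A := by
  have hNe : ∀ k, 0 ≤ s ^ k • N k e := fun k => smul_nonneg (pow_nonneg hs k)
    ((h.proj k).nonneg e he)
  have hNσ : ∀ j n, N j (∑ k ∈ Finset.range n, s ^ k • N k e) =
      if j < n then s ^ j • N j e else 0 := by
    intro j n
    rw [map_sum]
    simp only [map_smul, h.apply_apply, smul_ite, smul_zero]
    rw [Finset.sum_ite_eq]
    simp
  have hgen : genFun e T x s = supOf (Set.range fun n : ℕ => T (∑ k ∈ Finset.range n, s ^ k • N k e))
      (Set.range_nonempty _) := by
    unfold genFun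
    congr 1
    simp only [massFun_eq, h.levelProj_eq he hw, map_sum, map_smul]
  rw [hgen]
  refine le_antisymm (supOf_le ?_) (supOf_le ?_)
  · rintro _ ⟨n, rfl⟩
    refine subset_supOf _ _ ⟨_, ?_, rfl⟩
    rw [hA]
    intro j
    rw [hNσ]
    split_ifs
    · exact le_rfl
    · exact hNe j
  · rintro _ ⟨y, hy, rfl⟩
    rw [hA] at hy
    have hmono := monotone_sum_range hNe
    have hlub : IsLUB (Set.range fun n : ℕ => y⁺ ⊓ ∑ k ∈ Finset.range n, s ^ k • N k e) y⁺ := by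
      refine ⟨by rintro _ ⟨n, rfl⟩; exact inf_le_left, fun w hw' => ?_⟩
      refine h.le_of_forall_le he hw fun j => ?_
      -- On the j-th piece the partial sum with j + 1 terms is already s^j e, so truncating y⁺ by it
      -- loses nothing.
      have h1 := (h.proj j).mono (hw' ⟨j + 1, rfl⟩)
      rw [(h.proj j).map_inf, hNσ, if_pos j.lt_succ_self, inf_eq_left.2] at h1
      · exact h1
      · rw [(h.proj j).map_posPart]
        exact sup_le (hy j) (hNe j)
    refine (supOf _ _).lower' (hT.mono (le_posPart y)) ?_
    refine mem_of_isLUB _ (hT.isLUB (fun m n hmn => inf_le_inf_left _ (hmono hmn)) hlub) fun n => ?_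
    exact (supOf _ _).lower' (hT.mono inf_le_right) (subset_supOf _ _ ⟨n, rfl⟩)

end IsLevels

end FunctionalCalculus

theorem isLUB_coe_ereal {f : ℕ → ℝ} {a : ℝ} (h : IsLUB (Set.range f) a) :
    IsLUB (Set.range fun n => (f n : EReal)) (a : EReal) := by
  refine ⟨?_, fun w hw => ?_⟩
  · rintro _ ⟨n, rfl⟩
    exact EReal.coe_le_coe_iff.2 (h.1 ⟨n, rfl⟩)
  · induction w using EReal.rec with
    | bot => exact absurd (le_bot_iff.1 (hw ⟨0, rfl⟩)) (EReal.coe_ne_bot _)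
    | top => exact le_top
    | coe r =>
      refine EReal.coe_le_coe_iff.2 (h.2 ?_)
      rintro _ ⟨n, rfl⟩
      exact EReal.coe_le_coe_iff.1 (hw ⟨n, rfl⟩)

/-! ### Existence of the functional value of t ↦ s^t by step functions. -/

namespace Step

theorem eval_zero (t : ℝ) : Step.eval 0 t = 0 := by simp [Step.eval]

theorem eval_add (φ ψ : Step) (t : ℝ) : (φ + ψ).eval t = φ.eval t + ψ.eval t := by
  unfold Step.eval
  refine Finsupp.sum_add_index' (fun J => ?_) fun J a b => ?_
  · simp
  · simp only [Set.indicator]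
    split_ifs <;> simp

open Classical in
theorem eval_single (J : EReal × EReal) (c t : ℝ) :
    Step.eval (Finsupp.single J c) t = if J.1 < (t : EReal) ∧ (t : EReal) ≤ J.2 then c else 0 := by
  unfold Step.eval
  rw [Finsupp.sum_single_index (by simp)]
  simp [Set.indicator]

theorem eval_sum {ι : Type*} (s : Finset ι) (φ : ι → Step) (t : ℝ) :
    Step.eval (∑ i ∈ s, φ i) t = ∑ i ∈ s, (φ i).eval t := by
  classical
  induction s using Finset.induction_on with
  | empty => simp [eval_zero]
  | insert a s ha ih => rw [Finset.sum_insert ha, Finset.sum_insert ha, eval_add, ih]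

end Step

section Layers

open Classical in
/-- The dyadic layer sum `∑_{j < m} 2⁻ⁿ [P ((j+1)/2ⁿ)]`. -/
noncomputable def layerSum (P : ℝ → Prop) (n m : ℕ) : ℝ :=
  ∑ j ∈ Finset.range m, if P (((j + 1 : ℕ) : ℝ) / 2 ^ n) then ((2 : ℝ) ^ n)⁻¹ else 0

variable {P : ℝ → Prop}

open Classical in
theorem layerSum_succ (P : ℝ → Prop) (n m : ℕ) : layerSum P n (m + 1) =
    layerSum P n m + if P (((m + 1 : ℕ) : ℝ) / 2 ^ n) then ((2 : ℝ) ^ n)⁻¹ else 0 :=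
  Finset.sum_range_succ _ _

theorem layerSum_mono (P : ℝ → Prop) (n : ℕ) : Monotone (layerSum P n) :=
  monotone_nat_of_le_succ fun m => by
    rw [layerSum_succ]
    refine le_add_of_nonneg_right ?_
    split_ifs <;> positivity

/-- A layer at height (m+1)/2ⁿ splits into two of half the thickness, at that height and just below
it, where P also holds. -/
theorem layerSum_refine (hP : ∀ c d, 0 < c → c ≤ d → P d → P c) (n m : ℕ) :
    layerSum P n m ≤ layerSum P (n + 1) (2 * m) := by
  induction m with
  | zero => simp [layerSum]
  | succ m ih =>
    rw [show 2 * (m + 1) = 2 * m + 1 + 1 by ring, layerSum_succ, layerSum_succ, layerSum_succ,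
      add_assoc]
    refine add_le_add ih ?_
    have h1 : (((2 * m + 1 + 1 : ℕ) : ℝ) / 2 ^ (n + 1)) = ((m + 1 : ℕ) : ℝ) / 2 ^ n := by
      rw [pow_succ]
      push_cast
      field_simp
      ring
    have h2 : ((2 * m + 1 : ℕ) : ℝ) / 2 ^ (n + 1) ≤ ((m + 1 : ℕ) : ℝ) / 2 ^ n := by
      rw [← h1]
      gcongr
      omega
    have h3 : ((2 : ℝ) ^ n)⁻¹ = ((2 : ℝ) ^ (n + 1))⁻¹ + ((2 : ℝ) ^ (n + 1))⁻¹ := by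
      rw [pow_succ]
      field_simp
      norm_num
    rw [h1]
    by_cases hp : P (((m + 1 : ℕ) : ℝ) / 2 ^ n)
    · rw [if_pos hp, if_pos hp, if_pos (hP _ _ (by positivity) h2 hp), h3]
    · rw [if_neg hp]
      split_ifs
      · positivity
      · simp

theorem layerSum_le {y : ℝ} (hy : 0 ≤ y) (hP : ∀ c, 0 < c → P c → c ≤ y) (n m : ℕ) :
    layerSum P n m ≤ y := by
  have h0 : ∀ m, layerSum P n m ≤ m / 2 ^ n := by
    intro m
    unfold layerSum
    refine (Finset.sum_le_card_nsmul _ _ ((2 : ℝ) ^ n)⁻¹ fun j _ => ?_).trans (le_of_eq ?_)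
    · split_ifs
      · exact le_rfl
      · positivity
    · simp [div_eq_mul_inv]
  induction m with
  | zero => simpa [layerSum] using hy
  | succ m ih =>
    by_cases hp : P (((m + 1 : ℕ) : ℝ) / 2 ^ n)
    · exact (h0 _).trans (hP _ (by positivity) hp)
    · rw [layerSum_succ, if_neg hp, add_zero]
      exact ih

theorem le_layerSum {y : ℝ} (hP : ∀ c, 0 < c → c < y → P c) (n m : ℕ) :
    min ((m : ℝ) / 2 ^ n) (y - (2 ^ n)⁻¹) ≤ layerSum P n m := by
  induction m with
  | zero => simp [layerSum]
  | succ m ih =>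
    have h0 : ((m + 1 : ℕ) : ℝ) / 2 ^ n = (m : ℝ) / 2 ^ n + ((2 : ℝ) ^ n)⁻¹ := by
      push_cast
      field_simp
    have hpos : (0 : ℝ) < (2 ^ n)⁻¹ := by positivity
    rcases lt_or_ge (((m + 1 : ℕ) : ℝ) / 2 ^ n) y with h | h
    · rw [layerSum_succ, if_pos (hP _ (by positivity) h), h0]
      rcases min_le_iff.1 ih with h1 | h1
      · exact (min_le_left _ _).trans (by linarith)
      · exact (min_le_right _ _).trans (by linarith)
    · refine (min_le_right _ _).trans (le_trans ?_ (layerSum_mono P n m.le_succ))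
      rwa [min_eq_right (by rw [h0] at h; linarith)] at ih

/-- The 4ⁿ layers of thickness 2⁻ⁿ reach height 2ⁿ, so both the range and the resolution improve
with n. -/
theorem isLUB_layerSum {y : ℝ} (hy : 0 ≤ y) (h1 : ∀ c, 0 < c → P c → c ≤ y)
    (h2 : ∀ c, 0 < c → c < y → P c) :
    IsLUB (Set.range fun n : ℕ => layerSum P n (4 ^ n)) y := by
  refine ⟨?_, fun w hw => ?_⟩
  · rintro _ ⟨n, rfl⟩
    exact layerSum_le hy h1 n _
  · by_contra! hlt
    obtain ⟨n, hn⟩ := exists_nat_gt (max y (y - w)⁻¹)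
    have hn2 : (n : ℝ) < 2 ^ n := by exact_mod_cast n.lt_two_pow_self
    have h3 := (le_layerSum h2 n (4 ^ n)).trans (hw ⟨n, rfl⟩)
    have h4 : (((4 ^ n : ℕ) : ℝ) / 2 ^ n) = 2 ^ n := by
      push_cast
      rw [show (4 : ℝ) = 2 * 2 by norm_num, mul_pow]
      field_simp
    rw [h4] at h3
    have h5 : y < n := (le_max_left _ _).trans_lt hn
    have h6 : (y - w)⁻¹ < 2 ^ n := ((le_max_right _ _).trans_lt hn).trans hn2
    have h7 : ((2 : ℝ) ^ n)⁻¹ < y - w := inv_lt_of_inv_lt₀ (sub_pos.2 hlt) h6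
    rcases min_le_iff.1 h3 with h | h <;> linarith

variable {E : Type*} [ConditionallyCompleteLattice E] [AddCommGroup E] [IsOrderedAddMonoid E]
  [Module ℝ E] [IsOrderedModule ℝ E]

/-- The interval J c is only required to lie between {f > c} and {f ≥ c}: a decreasing power has {f
≥ c} of the form (a,b], an increasing one {f > c}. -/
theorem exists_hasUpIntegral_of_layers (e x : E) {f : ℝ → ℝ} (hf : ∀ t, 0 ≤ f t)
    (J : ℝ → EReal × EReal)
    (hJ : ∀ c d t, 0 < c → c ≤ d → (J d).1 < ((t : ℝ) : EReal) ∧ (t : EReal) ≤ (J d).2 →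
      (J c).1 < (t : EReal) ∧ (t : EReal) ≤ (J c).2)
    (h1 : ∀ c t, 0 < c → (J c).1 < ((t : ℝ) : EReal) ∧ (t : EReal) ≤ (J c).2 → c ≤ f t)
    (h2 : ∀ c t, 0 < c → c < f t → (J c).1 < (t : EReal) ∧ (t : EReal) ≤ (J c).2) :
    ∃ A, HasUpIntegral e x (fun t => (f t : EReal)) A := by
  let φ : ℕ → Step := fun n => ∑ j ∈ Finset.range (4 ^ n),
    Finsupp.single (J (((j + 1 : ℕ) : ℝ) / 2 ^ n)) (((2 : ℝ) ^ n)⁻¹)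
  have hφ : ∀ n t, (φ n).eval t =
      layerSum (fun c => (J c).1 < (t : EReal) ∧ (t : EReal) ≤ (J c).2) n (4 ^ n) := by
    intro n t
    rw [Step.eval_sum]
    refine Finset.sum_congr rfl fun j _ => ?_
    rw [Step.eval_single]
    congr
  refine ⟨_, φ, fun t => monotone_nat_of_le_succ fun n => ?_, fun t => ?_, rfl⟩
  · rw [hφ, hφ]
    refine (layerSum_refine (fun c d hc hcd => hJ c d t hc hcd) n _).trans (layerSum_mono _ _ ?_)
    rw [pow_succ]
    omega
  · simp only [hφ]
    exact isLUB_coe_ereal (isLUB_layerSum (hf t) (fun c hc => h1 c t hc) fun c hc => h2 c t hc)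

theorem exists_hasUpIntegral_one (e x : E) : ∃ A, HasUpIntegral e x (fun _ => ((1 : ℝ) : EReal)) A := by
  refine ⟨_, fun _ => Finsupp.single (⊥, ⊤) 1, fun t => monotone_const, fun t => ?_, rfl⟩
  refine isLUB_coe_ereal ?_
  simp [Step.eval_single, EReal.bot_lt_coe]

theorem exists_hasUpIntegral_rpow (e x : E) {s : ℝ} (hs : 0 < s) :
    ∃ A, HasUpIntegral e x (fun t => ((s ^ t : ℝ) : EReal)) A := by
  rcases lt_trichotomy s 1 with h | rfl | h
  · have hl : Real.log s < 0 := Real.log_neg hs h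
    have key : ∀ c t : ℝ, 0 < c → (t ≤ Real.log c / Real.log s ↔ c ≤ s ^ t) := by
      intro c t hc
      rw [le_div_iff_of_neg hl, ← Real.log_rpow hs, Real.log_le_log_iff hc (Real.rpow_pos_of_pos hs t)]
    refine exists_hasUpIntegral_of_layers e x (fun t => (Real.rpow_pos_of_pos hs t).le)
      (fun c => (⊥, ((Real.log c / Real.log s : ℝ) : EReal))) ?_ ?_ ?_
    · intro c d t hc hcd
      simp only [EReal.bot_lt_coe, true_and, EReal.coe_le_coe_iff]
      rw [key c t hc, key d t (hc.trans_le hcd)]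
      exact hcd.trans
    · intro c t hc
      simp only [EReal.bot_lt_coe, true_and, EReal.coe_le_coe_iff]
      exact (key c t hc).1
    · intro c t hc hlt
      simp only [EReal.bot_lt_coe, true_and, EReal.coe_le_coe_iff]
      exact (key c t hc).2 hlt.le
  · simpa using exists_hasUpIntegral_one e x
  · have hl : 0 < Real.log s := Real.log_pos h
    have key : ∀ c t : ℝ, 0 < c → (Real.log c / Real.log s < t ↔ c < s ^ t) := by
      intro c t hc
      rw [div_lt_iff₀ hl, ← Real.log_rpow hs, Real.log_lt_log_iff hc (Real.rpow_pos_of_pos hs t)]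
    refine exists_hasUpIntegral_of_layers e x (fun t => (Real.rpow_pos_of_pos hs t).le)
      (fun c => (((Real.log c / Real.log s : ℝ) : EReal), ⊤)) ?_ ?_ ?_
    · intro c d t hc hcd
      simp only [le_top, and_true, EReal.coe_lt_coe_iff]
      rw [key c t hc, key d t (hc.trans_le hcd)]
      exact hcd.trans_lt
    · intro c t hc
      simp only [le_top, and_true, EReal.coe_lt_coe_iff]
      exact fun h => ((key c t hc).1 h).le
    · intro c t hc hlt
      simp only [le_top, and_true, EReal.coe_lt_coe_iff]
      exact (key c t hc).2 hlt

theorem hasUpIntegralIn_zero (e x : E) : HasUpIntegralIn e x (fun _ => 0) 0 := by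
  refine ⟨fun _ => le_rfl, fun _ => 0, fun t => monotone_const, fun t => ?_, ?_⟩
  · refine isLUB_coe_ereal ?_
    simp [Step.eval_zero]
  · refine (supOf_eq_of ?_).symm
    simp [Step.integral]

/-- The sets (-∞, -1/(n+1)] ∪ (0, ∞) increase to the complement of 0, and their integrals are
bounded by e. -/
theorem IsLevels.exists_hasUpIntegralIn_ne_zero {e x : E} {N : ℕ → E →ₗ[ℝ] E}
    (h : IsLevels e x N) (he : 0 ≤ e) (hw : ∀ x : E, |x| ⊓ e = 0 → x = 0) :
    ∃ u, HasUpIntegralIn e x (fun t => if t = 0 then 0 else 1) u := by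
  classical
  let φ : ℕ → Step := fun n => Finsupp.single (⊥, ((-(1 / ((n : ℝ) + 1)) : ℝ) : EReal)) 1 +
    Finsupp.single (0, ⊤) 1
  have hφ : ∀ n t, (φ n).eval t = (if t ≤ -(1 / ((n : ℝ) + 1)) then 1 else 0) +
      if 0 < t then 1 else 0 := by
    intro n t
    rw [Step.eval_add, Step.eval_single, Step.eval_single]
    simp only [EReal.bot_lt_coe, true_and, EReal.coe_le_coe_iff, le_top, and_true, EReal.coe_pos]
  have hle : ∀ n t, (φ n).eval t ≤ if t = 0 then 0 else 1 := by
    intro n t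
    have : (0 : ℝ) < 1 / ((n : ℝ) + 1) := by positivity
    rw [hφ]
    split_ifs <;> linarith
  have hmono : ∀ t, Monotone fun n => (φ n).eval t := by
    intro t m n hmn
    simp only [hφ]
    have : 1 / ((n : ℝ) + 1) ≤ 1 / ((m : ℝ) + 1) := by
      gcongr
    gcongr
    split_ifs <;> linarith
  have hbdd : BddAbove (Set.range fun n => (φ n).integral e x) := by
    refine ⟨e, ?_⟩
    rintro _ ⟨n, rfl⟩
    refine h.le_of_forall_le he hw fun k => ?_
    rw [h.apply_integral]
    have h0 := (h.proj k).nonneg e he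
    calc _ ≤ (1 : ℝ) • N k e := smul_le_smul_of_nonneg_right ((hle n k).trans (by
            split_ifs <;> norm_num)) h0
      _ = _ := one_smul _ _
  refine ⟨_, fun t => by beta_reduce; split_ifs <;> norm_num, φ, hmono, fun t => isLUB_coe_ereal ?_,
    (supOf_eq_of (isLUB_ciSup hbdd)).symm⟩
  refine ⟨?_, fun w hw' => ?_⟩
  · rintro _ ⟨n, rfl⟩
    exact hle n t
  · beta_reduce
    rcases lt_trichotomy t 0 with ht | rfl | ht
    · obtain ⟨n, hn⟩ := exists_nat_one_div_lt (neg_pos.2 ht)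
      have := hw' ⟨n, rfl⟩
      simp only [hφ] at this
      rw [if_pos (by linarith), if_neg ht.not_gt] at this
      rw [if_neg ht.ne]
      linarith
    · have := hw' ⟨0, rfl⟩
      simp only [hφ] at this
      norm_num at this
      simpa using this
    · have := hw' ⟨0, rfl⟩
      simp only [hφ] at this
      rw [if_neg (by norm_num; linarith), if_pos ht] at this
      rw [if_neg ht.ne']
      linarith

theorem IsLevels.exists_hasFunctionalValue_rpow {e x : E} {N : ℕ → E →ₗ[ℝ] E}
    (h : IsLevels e x N) (he : 0 ≤ e) (hw : ∀ x : E, |x| ⊓ e = 0 → x = 0) {s : ℝ} (hs : 0 ≤ s) :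
    ∃ A, HasFunctionalValue e x (fun t => ((s ^ t : ℝ) : EReal)) A := by
  rcases hs.eq_or_lt with rfl | hs
  -- The indicator of {0} is no increasing limit of step functions, as these are left continuous; it
  -- is written as 1 minus the indicator of t ≠ 0.
  · obtain ⟨G, hG⟩ := exists_hasUpIntegral_one e x
    obtain ⟨u, hu⟩ := h.exists_hasUpIntegralIn_ne_zero he hw
    refine ⟨_, _, _, _, G, u, 0, hG, hu, hasUpIntegralIn_zero e x, fun t => ?_, rfl⟩
    rw [← EReal.coe_sub]
    split_ifs with ht
    · simp [ht]
    · simp [Real.zero_rpow ht]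
  · obtain ⟨G, hG⟩ := exists_hasUpIntegral_rpow e x hs
    refine ⟨_, _, _, _, G, 0, 0, hG, hasUpIntegralIn_zero e x, hasUpIntegralIn_zero e x,
      fun t => ?_, rfl⟩
    simp

theorem IsNatural.functionalValue {e : E} {T : E →ₗ[ℝ] E} (hT : IsConditionalTriple e T) {x : E}
    (hx : IsNatural e T x) {s : ℝ} (hs : 0 ≤ s) :
    ∃ y : SupCompletion E,
      (∀ z, HasFunctionalValue e x (fun t => ((s ^ t : ℝ) : EReal)) z ↔ z = y) ∧
      genFun e T x s = extend T y := by
  have h := hx.isLevels hT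
  have he := hT.unit_nonneg
  have hw := hT.unit_weak
  obtain ⟨A, hA⟩ := h.exists_hasFunctionalValue_rpow he hw hs
  have hc := h.carrier_of_hasFunctionalValue he hw hA
  refine ⟨A, fun z => ⟨fun hz => SupCompletion.ext ?_, fun hz => hz ▸ hA⟩, ?_⟩
  · rw [hc, h.carrier_of_hasFunctionalValue he hw hz]
  · refine h.genFun_eq_extend he hw hT hs ?_
    simpa only [Real.rpow_natCast] using hc

end Layers

/-! ### T commutes with band projections of its range; the product on E^s and suprema. -/

section Product

variable {E : Type*} [ConditionallyCompleteLattice E] [AddCommGroup E] [IsOrderedAddMonoid E]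
  [Module ℝ E] [IsOrderedModule ℝ E]

/-! ### Conditional expectations commute with band projections of their range -/

namespace IsConditionalTriple

variable {e : E} {T : E →ₗ[ℝ] E}

theorem map_eq_iff (hT : IsConditionalTriple e T) {y : E} : y ∈ Set.range T ↔ T y = y :=
  ⟨by rintro ⟨z, rfl⟩; exact hT.idem z, fun h => ⟨y, h⟩⟩

theorem map_sup_of_fixed (hT : IsConditionalTriple e T) {x y : E} (hx : T x = x) (hy : T y = y) :
    T (x ⊔ y) = x ⊔ y :=
  hT.map_eq_iff.1 (hT.range_sup x ⟨x, hx⟩ y ⟨y, hy⟩)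

theorem map_inf_of_fixed (hT : IsConditionalTriple e T) {x y : E} (hx : T x = x) (hy : T y = y) :
    T (x ⊓ y) = x ⊓ y := by
  have := hT.map_sup_of_fixed (x := -x) (y := -y) (by rw [map_neg, hx]) (by rw [map_neg, hy])
  rwa [← neg_inf, map_neg, neg_inj] at this

theorem map_bandProj_of_fixed (hT : IsConditionalTriple e T) {u : E} (hu : 0 ≤ u) (h : T u = u) :
    T (bandProj u e) = bandProj u e := by
  have h1 := isLUB_bandProj u hT.unit_nonneg
  rw [abs_of_nonneg hu] at h1
  have h2 := hT.isLUB (fun m n hmn => inf_le_inf_left _ (nsmul_le_nsmul_left hu hmn)) h1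
  have h3 : ∀ n : ℕ, T (e ⊓ n • u) = e ⊓ n • u := fun n =>
    hT.map_inf_of_fixed hT.map_unit (by rw [map_nsmul, h])
  simp only [h3] at h2
  exact h2.unique h1

theorem isLUB_inf_nsmul_unit (hT : IsConditionalTriple e T) {y : E} (hy : 0 ≤ y) :
    IsLUB (Set.range fun n : ℕ => y ⊓ n • e) y := by
  have h1 := isLUB_bandProj e hy
  have h2 := bandProj_abs_self e
  rw [abs_of_nonneg hT.unit_nonneg] at h1 h2
  have h3 := (isBandProjection_bandProjₗ e).compl.eq_zero_of_unit hT.unit_weak hT.unit_nonneg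
    (by simp [h2]) y
  have h4 : y = bandProj e y := by simpa [sub_eq_zero] using h3
  rwa [← h4] at h1

/-- For 0 ≤ y ≤ ne one has TQy ≤ nQe, which lies in the band of Q; order continuity removes the
bound. -/
theorem map_apply_mem_band (hT : IsConditionalTriple e T) {Q : E →ₗ[ℝ] E}
    (hQ : IsBandProjection Q) (h : T (Q e) = Q e) (y : E) : Q (T (Q y)) = T (Q y) := by
  refine IsBandProjection.ext_nonneg (S := Q ∘ₗ T ∘ₗ Q) (T := T ∘ₗ Q) (fun y hy => ?_) y
  simp only [LinearMap.comp_apply]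
  have hb : ∀ n : ℕ, Q (T (Q (y ⊓ n • e))) = T (Q (y ⊓ n • e)) := by
    intro n
    have h0 : 0 ≤ y ⊓ n • e := le_inf hy (nsmul_nonneg hT.unit_nonneg n)
    refine hQ.eq_self_of_le (z := n • Q e) (hT.nonneg _ (hQ.nonneg _ h0)) ?_ ?_
    · have := hT.mono (hQ.mono (inf_le_right : y ⊓ n • e ≤ n • e))
      rwa [map_nsmul, map_nsmul, h] at this
    · rw [map_nsmul, hQ.idem]
  have h1 := hT.isLUB (fun m n hmn => hQ.mono (inf_le_inf_left _
    (nsmul_le_nsmul_left hT.unit_nonneg hmn))) (hQ.isLUB (hT.isLUB_inf_nsmul_unit hy))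
  have h2 := hQ.isLUB h1
  simp only [hb] at h2
  exact h2.unique h1

theorem comm_of_fixed (hT : IsConditionalTriple e T) {Q : E →ₗ[ℝ] E} (hQ : IsBandProjection Q)
    (h : T (Q e) = Q e) (y : E) : T (Q y) = Q (T y) := by
  have h1 := hT.map_apply_mem_band hQ h y
  have h2 := hT.map_apply_mem_band hQ.compl (by simp [hT.map_unit, h]) y
  simp only [LinearMap.sub_apply, LinearMap.id_apply, map_sub] at h2
  rw [h1] at h2
  rw [sub_self, sub_zero] at h2
  exact (sub_right_inj.1 h2).symm

end IsConditionalTriple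

/-! ### Spectral projections -/

theorem posPart_bandProj_self (u : E) : bandProj u⁺ u = u⁺ := by
  have h1 := bandProj_abs_self u⁺
  rw [abs_of_nonneg (posPart_nonneg u)] at h1
  have h2 := bandProj_eq_zero_of_inf_eq_zero (posPart_inf_negPart_eq_zero u)
  have h3 := bandProj_add u⁺ u⁺ (-u⁻)
  rwa [bandProj_neg, h1, h2, neg_zero, add_zero, ← sub_eq_add_neg, posPart_sub_negPart] at h3

/-- The band projection `P_{b > βe}`. -/
noncomputable def aboveProj (e b : E) (β : ℝ) : E →ₗ[ℝ] E := bandProjₗ (b - β • e)⁺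

theorem isBandProjection_aboveProj (e b : E) (β : ℝ) : IsBandProjection (aboveProj e b β) :=
  isBandProjection_bandProjₗ _

theorem smul_aboveProj_le (e b : E) (β : ℝ) : β • aboveProj e b β e ≤ aboveProj e b β b := by
  rw [← sub_nonneg, ← map_smul, ← map_sub]
  exact (posPart_nonneg (b - β • e)).trans_eq (posPart_bandProj_self _).symm

theorem sub_aboveProj_le (e b : E) (β : ℝ) :
    b - aboveProj e b β b ≤ β • (e - aboveProj e b β e) := by
  have h : aboveProj e b β (b - β • e) = (b - β • e)⁺ := posPart_bandProj_self _
  have h1 : (b - β • e) - aboveProj e b β (b - β • e) ≤ 0 := by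
    rw [h, sub_nonpos]
    exact le_posPart _
  rw [← sub_nonpos]
  convert h1 using 1
  rw [map_sub, map_smul, smul_sub]
  abel

theorem aboveProj_mono {e b c : E} (h : b ≤ c) (β : ℝ) {y : E} (hy : 0 ≤ y) :
    aboveProj e b β y ≤ aboveProj e c β y := by
  refine (isLUB_bandProj _ hy).2 ?_
  rintro _ ⟨n, rfl⟩
  refine le_trans (inf_le_inf_left _ (nsmul_le_nsmul_right ?_ n)) ((isLUB_bandProj _ hy).1 ⟨n, rfl⟩)
  rw [abs_of_nonneg (posPart_nonneg _), abs_of_nonneg (posPart_nonneg _)]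
  exact posPart_mono (sub_le_sub_right h _)

theorem IsConditionalTriple.map_aboveProj {e : E} {T : E →ₗ[ℝ] E} (hT : IsConditionalTriple e T)
    {b : E} (hb : T b = b) (β : ℝ) : T (aboveProj e b β e) = aboveProj e b β e := by
  refine hT.map_bandProj_of_fixed (posPart_nonneg _) ?_
  exact hT.map_sup_of_fixed (by rw [map_sub, map_smul, hb, hT.map_unit]) (map_zero T)

/-- Freudenthal's theorem for a positive operator `M` that commutes with the spectral projections
of `b`: `M b` is the least upper bound of the elements `β P_{b > βe} M e`. -/
theorem apply_le_of_forall_aboveProj_le {e b w : E} {M : E →ₗ[ℝ] E} (hM : ∀ x, 0 ≤ x → 0 ≤ M x)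
    (he : 0 ≤ e) {K : ℝ} (hbK : b ≤ K • e)
    (hcomm : ∀ β y, M (aboveProj e b β y) = aboveProj e b β (M y))
    (hw : ∀ β : ℝ, 0 ≤ β → β • aboveProj e b β (M e) ≤ w) : M b ≤ w := by
  have hQ := isBandProjection_aboveProj e b
  have hup : ∀ β : ℝ, M b - aboveProj e b β (M b) ≤ β • (M e - aboveProj e b β (M e)) := by
    intro β
    have := mono_of_nonneg hM (sub_aboveProj_le e b β)
    simpa only [map_sub, map_smul, hcomm] using this
  have hw0 : 0 ≤ w := by simpa using hw 0 le_rfl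
  refine sub_nonpos.1 (nonpos_of_forall_le_smul (u := M e) fun δ hδ => ?_)
  set v := w - M b + δ • M e with hv
  suffices h : 0 ≤ v by
    rw [← sub_nonneg]
    convert h using 1
    rw [hv]; abel
  have hstep : ∀ β γ : ℝ, 0 ≤ β → γ = β + δ → 0 ≤ aboveProj e b γ v → 0 ≤ aboveProj e b β v := by
    intro β γ hβ hγ h
    have pQ := hQ β
    have pQ' := hQ γ
    have hwβ := hw β hβ
    have hupγ := hup γ
    generalize aboveProj e b β = Q at pQ hwβ ⊢
    generalize aboveProj e b γ = Q' at h pQ' hupγ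
    have h1 := pQ.nonneg _ h
    have h3 := pQ.mono (pQ'.compl.mono hwβ)
    have h4 := pQ.mono hupγ
    simp only [LinearMap.sub_apply, LinearMap.id_apply, map_smul, map_sub, pQ'.comm pQ,
      pQ.idem] at h3 h4
    have h5 := add_nonneg h1 (add_nonneg (sub_nonneg.2 h3) (sub_nonneg.2 h4))
    convert h5 using 1
    rw [hv, hγ]
    simp only [map_add, map_sub, map_smul]
    module
  -- Descent from level nδ ≥ K, above which nothing of b remains, to level 0.
  have hall : ∀ n i j : ℕ, K ≤ n * δ → i + j = n → 0 ≤ aboveProj e b (j * δ) v := by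
    intro n i
    induction i with
    | zero =>
      intro j hn hj
      have h0 : (b - ((j : ℝ) * δ) • e)⁺ = 0 := by
        rw [posPart_eq_zero, sub_nonpos]
        refine hbK.trans (smul_le_smul_of_nonneg_right ?_ he)
        rw [zero_add] at hj
        rwa [← hj] at hn
      unfold aboveProj
      rw [h0]
      simp [bandProj]
    | succ i ih =>
      intro j hn hj
      refine hstep _ ((j + 1 : ℕ) * δ) (by positivity) (by push_cast; ring) (ih (j + 1) hn (by omega))
  obtain ⟨n, hn⟩ := exists_nat_ge (K / δ)
  have h0 := hall n n 0 ((div_le_iff₀ hδ).1 hn) rfl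
  rw [Nat.cast_zero, zero_mul] at h0
  have h1 := hup 0
  have h2 := (hQ 0).compl.nonneg _ hw0
  have h3 := smul_nonneg hδ.le ((hQ 0).compl.nonneg _ (hM e he))
  simp only [LinearMap.sub_apply, LinearMap.id_apply] at h2 h3
  rw [zero_smul] at h1
  have h5 := add_nonneg h0 (add_nonneg h2 (add_nonneg h3 (sub_nonneg.2 h1)))
  convert h5 using 1
  rw [hv]
  simp only [map_add, map_sub, map_smul]
  module

/-! ### The product -/

/-- M acts on b as multiplication by Me. Freudenthal's theorem is used twice, for b under M and then
for Me under β P_{b > βe}, to bound Mb by products of components. -/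
theorem apply_mem_mul {e b : E} {M : E →ₗ[ℝ] E} (hM : ∀ x, 0 ≤ x → 0 ≤ M x) (he : 0 ≤ e)
    {K : ℝ} (hb : 0 ≤ b) (hbK : b ≤ K • e) (haK : M e ≤ K • e) (hK : 0 ≤ K)
    (hcomm : ∀ β y, M (aboveProj e b β y) = aboveProj e b β (M y))
    {A B : SupCompletion E} (hA : M e ∈ A.carrier) (hB : b ∈ B.carrier) :
    M b ∈ (mul e A B).carrier := by
  set Z : Set E := {z | ∃ (α β : ℝ) (p q : E), 0 ≤ α ∧ 0 ≤ β ∧ p ⊓ (e - p) = 0 ∧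
    q ⊓ (e - q) = 0 ∧ α • p ≤ M e ∧ β • q ≤ b ∧ z = (α * β) • (p ⊓ q)} with hZ
  have hZmem : ∀ α β : ℝ, 0 ≤ α → 0 ≤ β →
      (α * β) • aboveProj e (M e) α (aboveProj e b β e) ∈ Z := by
    intro α β hα hβ
    have h1 := isBandProjection_aboveProj e (M e) α
    have h2 := isBandProjection_aboveProj e b β
    refine ⟨α, β, _, _, hα, hβ, h1.inf_compl he, h2.inf_compl he, ?_, ?_, ?_⟩
    · exact (smul_aboveProj_le _ _ _).trans (h1.le_self _ (hM e he))
    · exact (smul_aboveProj_le _ _ _).trans (h2.le_self _ hb)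
    · rw [h1.inf_apply h2 he]
  have hne : Z.Nonempty := ⟨_, hZmem 0 0 le_rfl le_rfl⟩
  have hbdd : BddAbove Z := by
    refine ⟨(K * K) • e, ?_⟩
    rintro _ ⟨α, β, p, q, hα, hβ, hp, hq, hpa, hqb, rfl⟩
    obtain ⟨P, hP, rfl⟩ := exists_bandProjection_of_component hp
    obtain ⟨Q, hQ, rfl⟩ := exists_bandProjection_of_component hq
    rw [hP.inf_apply hQ he]
    have h1 := hQ.mono (hP.mono (hpa.trans haK))
    have h2 := hP.mono (hQ.mono (hqb.trans hbK))
    simp only [map_smul, hP.idem, hQ.idem] at h1 h2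
    rw [← hP.comm hQ] at h1
    calc (α * β) • P (Q e) = β • α • P (Q e) := by rw [smul_smul, mul_comm]
      _ ≤ β • K • P (Q e) := smul_le_smul_left' hβ h1
      _ = K • β • P (Q e) := smul_comm _ _ _
      _ ≤ K • K • P (Q e) := smul_le_smul_left' hK h2
      _ = (K * K) • P (Q e) := smul_smul _ _ _
      _ ≤ (K * K) • e := smul_le_smul_left' (mul_nonneg hK hK)
        ((hP.le_self _ (hQ.nonneg _ he)).trans (hQ.le_self _ he))
  have hlub := isLUB_csSup hne hbdd
  have hmem : sSup Z ∈ (mul e A B).carrier := by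
    refine (mul e A B).lub_mem' Z ?_ hne _ hlub
    rintro _ ⟨α, β, p, q, hα, hβ, hp, hq, hpa, hqb, rfl⟩
    refine subset_supOf _ _ (Or.inr ⟨α, β, p, q, hα, hβ, hp, hq, ?_, ?_, rfl⟩)
    · exact (of_le_iff _ _).2 (A.lower' hpa hA)
    · exact (of_le_iff _ _).2 (B.lower' hqb hB)
  refine (mul e A B).lower' ?_ hmem
  refine apply_le_of_forall_aboveProj_le hM he hbK hcomm fun β hβ => ?_
  have h2 := isBandProjection_aboveProj e b β
  refine apply_le_of_forall_aboveProj_le (M := β • aboveProj e b β)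
    (fun x hx => smul_nonneg hβ (h2.nonneg x hx)) he haK (fun α y => ?_) fun α hα => ?_
  · rw [LinearMap.smul_apply, LinearMap.smul_apply, map_smul,
      h2.comm (isBandProjection_aboveProj e (M e) α)]
  · rw [LinearMap.smul_apply, map_smul, smul_smul]
    exact hlub.1 (hZmem α β hα hβ)

/-- If `αp ≤ sup a_n`, then the bands on which `a_n > γe`, for a fixed `γ < α`, exhaust `p`. -/
theorem isLUB_aboveProj {e : E} (he : 0 ≤ e) {a : ℕ → E} (ha0 : ∀ n, 0 ≤ a n) {P : E →ₗ[ℝ] E}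
    (hP : IsBandProjection P) {α γ : ℝ} (hα : 0 ≤ α) (hγ : γ < α)
    (h : α • P e ∈ (supOf (Set.range a) (Set.range_nonempty a)).carrier) :
    IsLUB (Set.range fun n => aboveProj e (a n) γ (P e)) (P e) := by
  have hPe := hP.nonneg e he
  have hA := fun n => isBandProjection_aboveProj e (a n) γ
  refine ⟨?_, fun w hw => ?_⟩
  · rintro _ ⟨n, rfl⟩
    exact (hA n).le_self _ hPe
  · have h1 := (mem_supOf_range_iff a _).1 h
    -- Where a n > γe the truncation is at most αPe, elsewhere at most γPe.
    have h2 : α • P e ≤ γ • P e + (α - γ) • w := by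
      refine h1.2 ?_
      rintro _ ⟨n, rfl⟩
      set r := α • P e ⊓ a n with hr
      have hr0 : 0 ≤ r := le_inf (smul_nonneg hα hPe) (ha0 n)
      have hPr : P r = r := hP.eq_self_of_le hr0 inf_le_left (by rw [map_smul, hP.idem])
      have h3 : aboveProj e (a n) γ r ≤ α • aboveProj e (a n) γ (P e) := by
        rw [← map_smul]
        exact (hA n).mono inf_le_left
      have h4 : r - aboveProj e (a n) γ r ≤ γ • (P e - aboveProj e (a n) γ (P e)) := by
        have h5 := ((hA n).compl.mono (inf_le_right : r ≤ a n)).trans (sub_aboveProj_le e (a n) γ)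
        have h6 := hP.mono h5
        simp only [LinearMap.sub_apply, LinearMap.id_apply, map_sub, map_smul] at h6
        rwa [hP.comm (hA n), hP.comm (hA n), hPr] at h6
      calc r = aboveProj e (a n) γ r + (r - aboveProj e (a n) γ r) := by abel
        _ ≤ α • aboveProj e (a n) γ (P e) + γ • (P e - aboveProj e (a n) γ (P e)) :=
          add_le_add h3 h4
        _ = γ • P e + (α - γ) • aboveProj e (a n) γ (P e) := by module
        _ ≤ _ := by
          have := smul_le_smul_left' (sub_nonneg.2 hγ.le) (hw ⟨n, rfl⟩)
          exact add_le_add_right this _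
    have h3 : (α - γ) • P e ≤ (α - γ) • w := by
      rw [sub_smul, sub_le_iff_le_add']
      exact h2
    have h4 := smul_le_smul_left' (inv_nonneg.2 (sub_nonneg.2 hγ.le)) h3
    rwa [inv_smul_smul₀ (sub_pos.2 hγ).ne', inv_smul_smul₀ (sub_pos.2 hγ).ne'] at h4

theorem smul_mem_of_forall_lt (C : SupCompletion E) {z : E} (hz : 0 ≤ z) {c : ℝ} (hc : 0 < c)
    (h : ∀ d : ℝ, 0 < d → d < c → d • z ∈ C.carrier) : c • z ∈ C.carrier := by
  obtain ⟨u, hu, huc, hlim⟩ := exists_seq_strictMono_tendsto' hc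
  exact mem_of_isLUB C (isLUB_smul_of_nonneg (isLUB_of_tendsto_atTop hu.monotone hlim) hz)
    fun n => h _ (huc n).1 (huc n).2

theorem isLUB_const_smul {f : ℕ → E} {a : E} (h : IsLUB (Set.range f) a) {c : ℝ} (hc : 0 < c) :
    IsLUB (Set.range fun n => c • f n) (c • a) := by
  refine ⟨?_, fun w hw => ?_⟩
  · rintro _ ⟨n, rfl⟩
    exact smul_le_smul_left' hc.le (h.1 ⟨n, rfl⟩)
  · have h1 : a ≤ c⁻¹ • w := by
      refine h.2 ?_
      rintro _ ⟨n, rfl⟩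
      have := smul_le_smul_left' (inv_nonneg.2 hc.le) (hw ⟨n, rfl⟩)
      rwa [inv_smul_smul₀ hc.ne'] at this
    have := smul_le_smul_left' hc.le h1
    rwa [smul_inv_smul₀ hc.ne'] at this

/-- No single index need satisfy αp ≤ M n e and βq ≤ b n. But for γ < α and δ < β the bands where M
n e > γe and b n > δe exhaust p ⊓ q, and on them γδ is dominated by M n (b n). -/
theorem mul_supOf_le {e : E} {T : E →ₗ[ℝ] E} (hT : IsConditionalTriple e T) {M : ℕ → E →ₗ[ℝ] E}
    {b : ℕ → E} (hM : ∀ n x, 0 ≤ x → 0 ≤ M n x) (hMe : Monotone fun n => M n e) (hb : Monotone b)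
    (hb0 : ∀ n, 0 ≤ b n) (hTb : ∀ n, T (b n) = b n)
    (hcomm : ∀ n (Q : E →ₗ[ℝ] E), IsBandProjection Q → T (Q e) = Q e → ∀ y, M n (Q y) = Q (M n y))
    {C : SupCompletion E} (hC : ∀ n, M n (b n) ∈ C.carrier) :
    mul e (supOf (Set.range fun n => M n e) (Set.range_nonempty _))
      (supOf (Set.range b) (Set.range_nonempty b)) ≤ C := by
  have he := hT.unit_nonneg
  have h0 : (0 : E) ∈ C.carrier := C.lower' (hM 0 _ (hb0 0)) (hC 0)
  refine supOf_le ?_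
  rintro _ (rfl | ⟨α, β, p, q, hα, hβ, hp, hq, hpA, hqB, rfl⟩)
  · exact h0
  obtain ⟨P, hP, rfl⟩ := exists_bandProjection_of_component hp
  obtain ⟨Q, hQ, rfl⟩ := exists_bandProjection_of_component hq
  rw [of_le_iff] at hpA hqB
  rw [hP.inf_apply hQ he]
  have hPQ : 0 ≤ P (Q e) := hP.nonneg _ (hQ.nonneg _ he)
  rcases hα.eq_or_lt with rfl | hα'
  · simpa using h0
  rcases hβ.eq_or_lt with rfl | hβ'
  · simpa using h0
  have key : ∀ γ δ : ℝ, 0 < γ → γ < α → 0 < δ → δ < β → (δ * γ) • P (Q e) ∈ C.carrier := by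
    intro γ δ hγ hγα hδ hδβ
    set F := fun n => aboveProj e (M n e) γ with hF
    set G := fun n => aboveProj e (b n) δ with hG
    have hFp : ∀ n, IsBandProjection (F n) := fun n => isBandProjection_aboveProj _ _ _
    have hGp : ∀ n, IsBandProjection (G n) := fun n => isBandProjection_aboveProj _ _ _
    have hF1 : IsLUB (Set.range fun n => F n (P e)) (P e) :=
      isLUB_aboveProj he (fun n => hM n e he) hP hα hγα hpA
    have hG1 : IsLUB (Set.range fun n => G n (Q e)) (Q e) :=
      isLUB_aboveProj he hb0 hQ hβ hδβ hqB
    have hlub : IsLUB (Set.range fun n => F n (G n (P (Q e)))) (P (Q e)) := by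
      refine ⟨?_, fun w hw => ?_⟩
      · rintro _ ⟨n, rfl⟩
        exact ((hFp n).le_self _ ((hGp n).nonneg _ hPQ)).trans ((hGp n).le_self _ hPQ)
      -- Monotonicity decouples the two indices, so the suprema can be taken one after the other.
      · have h1 : ∀ m n, F m (G n (P (Q e))) ≤ w := by
          intro m n
          refine le_trans ?_ (hw ⟨max m n, rfl⟩)
          refine (aboveProj_mono (hMe (le_max_left m n)) γ ((hGp n).nonneg _ hPQ)).trans ?_
          exact (hFp _).mono (aboveProj_mono (hb (le_max_right m n)) δ hPQ)
        have h2 : ∀ m, F m (P (Q e)) ≤ w := by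
          intro m
          refine ((hFp m).isLUB (hP.isLUB hG1)).2 ?_
          rintro _ ⟨n, rfl⟩
          simp only
          rw [hP.comm (hGp n)]
          exact h1 m n
        have h3 := hQ.isLUB hF1
        rw [hP.comm hQ]
        refine h3.2 ?_
        rintro _ ⟨m, rfl⟩
        simp only
        rw [hQ.comm (hFp m), ← hP.comm hQ]
        exact h2 m
    refine mem_of_isLUB C (isLUB_const_smul hlub (mul_pos hδ hγ)) fun n => C.lower' ?_ (hC n)
    have hMn := fun {x y : E} (h : x ≤ y) => mono_of_nonneg (hM n) h
    -- b n is T-fixed, so its spectral projections are among those that commute with M n.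
    have hGe : T (G n e) = G n e := hT.map_aboveProj (hTb n) δ
    calc (δ * γ) • F n (G n (P (Q e))) ≤ (δ * γ) • F n (G n e) :=
          smul_le_smul_left' (mul_pos hδ hγ).le ((hFp n).mono ((hGp n).mono
            ((hP.le_self _ (hQ.nonneg _ he)).trans (hQ.le_self _ he))))
      _ = δ • G n (γ • F n e) := by rw [map_smul, smul_smul, (hFp n).comm (hGp n)]
      _ ≤ δ • G n (F n (M n e)) := smul_le_smul_left' hδ.le ((hGp n).mono (smul_aboveProj_le _ _ _))
      _ ≤ δ • G n (M n e) :=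
          smul_le_smul_left' hδ.le ((hGp n).mono ((hFp n).le_self _ (hM n e he)))
      _ = M n (δ • G n e) := by rw [map_smul, hcomm n _ (hGp n) hGe]
      _ ≤ M n (G n (b n)) := hMn (smul_aboveProj_le _ _ _)
      _ ≤ M n (b n) := hMn ((hGp n).le_self _ (hb0 n))
  rw [mul_comm, mul_smul]
  refine smul_mem_of_forall_lt C (smul_nonneg hα hPQ) hβ' fun δ hδ hδβ => ?_
  rw [smul_comm]
  refine smul_mem_of_forall_lt C (smul_nonneg hδ.le hPQ) hα' fun γ hγ hγα => ?_
  rw [smul_comm, smul_smul]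
  exact key γ δ hγ hγα hδ hδβ

end Product

/-! ### Generating functions of independent sums. -/

section Generating

variable {E : Type*} [ConditionallyCompleteLattice E] [AddCommGroup E] [IsOrderedAddMonoid E]
  [Module ℝ E] [IsOrderedModule ℝ E]

/-- The supremum in `E^s` of the partial sums of `∑ sᵏ T N_k e`. -/
noncomputable def genSup (e : E) (T : E →ₗ[ℝ] E) (N : ℕ → E →ₗ[ℝ] E) (s : ℝ) : SupCompletion E :=
  supOf (Set.range fun n : ℕ => ∑ k ∈ Finset.range n, s ^ k • T (N k e)) (Set.range_nonempty _)

theorem IsLevels.genFun_eq {e x : E} {T : E →ₗ[ℝ] E} (hT : IsConditionalTriple e T)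
    {N : ℕ → E →ₗ[ℝ] E} (h : IsLevels e x N) (s : ℝ) : genFun e T x s = genSup e T N s := by
  unfold genFun genSup
  simp only [massFun_eq, h.levelProj_eq hT.unit_nonneg hT.unit_weak]

/-- The generating function of a sum of two independent partitions is the product of their
generating functions. -/
theorem genSup_convPartition {e : E} {T : E →ₗ[ℝ] E} (hT : IsConditionalTriple e T)
    {N M : ℕ → E →ₗ[ℝ] E} (hN : ∀ k, IsBandProjection (N k)) (hM : ∀ k, IsBandProjection (M k))
    (hind : ∀ k m, T (N k (M m e)) = T (N k (T (M m e)))) {s : ℝ} (hs : 0 ≤ s) :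
    genSup e T (convPartition N M) s = mul e (genSup e T N s) (genSup e T M s) := by
  have he := hT.unit_nonneg
  set L : ℕ → E →ₗ[ℝ] E := fun n => T ∘ₗ ∑ k ∈ Finset.range n, s ^ k • N k with hL
  set b : ℕ → E := fun n => ∑ m ∈ Finset.range n, s ^ m • T (M m e) with hb
  set f : ℕ → ℕ → E := fun k m => s ^ (k + m) • T (N k (M m e)) with hf
  have hLapp : ∀ n y, L n y = ∑ k ∈ Finset.range n, s ^ k • T (N k y) := by
    intro n y
    simp [hL]
  have hpos : ∀ {P : ℕ → E →ₗ[ℝ] E}, (∀ k, IsBandProjection (P k)) → ∀ k y, 0 ≤ y →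
      0 ≤ s ^ k • T (P k y) := fun hP k y hy =>
    smul_nonneg (pow_nonneg hs k) (hT.nonneg _ ((hP k).nonneg y hy))
  have hf0 : ∀ k m, 0 ≤ f k m := fun k m => smul_nonneg (pow_nonneg hs _)
    (hT.nonneg _ ((hN k).nonneg _ ((hM m).nonneg e he)))
  have hLpos : ∀ n y, 0 ≤ y → 0 ≤ L n y := fun n y hy => by
    rw [hLapp]
    exact Finset.sum_nonneg fun k _ => hpos hN k y hy
  have hb0 : ∀ n, 0 ≤ b n := fun n => Finset.sum_nonneg fun k _ => hpos hM k e he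
  have hTb : ∀ n, T (b n) = b n := fun n => by simp [hb, map_sum, hT.idem]
  have hcomm : ∀ n (Q : E →ₗ[ℝ] E), IsBandProjection Q → T (Q e) = Q e →
      ∀ y, L n (Q y) = Q (L n y) := by
    intro n Q hQ hTQ y
    rw [hLapp, hLapp, map_sum]
    refine Finset.sum_congr rfl fun k _ => ?_
    rw [(hN k).comm hQ, hT.comm_of_fixed hQ hTQ, map_smul]
  -- Independence enters here, removing the inner T from T N_k T M_m e.
  have hLb : ∀ n, L n (b n) = ∑ k ∈ Finset.range n, ∑ m ∈ Finset.range n, f k m := by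
    intro n
    rw [hLapp]
    refine Finset.sum_congr rfl fun k _ => ?_
    simp only [hb, hf, map_sum, map_smul, Finset.smul_sum, smul_smul, pow_add, hind]
  have hconv : ∀ n, ∑ l ∈ Finset.range n, s ^ l • T (convPartition N M l e) =
      ∑ l ∈ Finset.range n, ∑ p ∈ Finset.HasAntidiagonal.antidiagonal l, f p.1 p.2 := by
    intro n
    refine Finset.sum_congr rfl fun l _ => ?_
    rw [convPartition_apply, map_sum, Finset.smul_sum]
    refine Finset.sum_congr rfl fun p hp => ?_
    rw [← Finset.HasAntidiagonal.mem_antidiagonal.1 hp]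
  have hLe : genSup e T N s = supOf (Set.range fun n => L n e) (Set.range_nonempty _) := by
    unfold genSup
    simp only [hLapp]
  rw [hLe]
  refine le_antisymm (supOf_le ?_) ?_
  · rintro _ ⟨n, rfl⟩
    simp only
    rw [hconv]
    refine (mul e _ _).lower' ((sum_triangle_le_sum_square hf0 n).trans_eq (hLb n).symm) ?_
    have hK : ∀ {P : ℕ → E →ₗ[ℝ] E}, (∀ k, IsBandProjection (P k)) →
        ∑ k ∈ Finset.range n, s ^ k • T (P k e) ≤ (∑ k ∈ Finset.range n, s ^ k) • e := by
      intro P hP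
      rw [Finset.sum_smul]
      refine Finset.sum_le_sum fun k _ => smul_le_smul_left' (pow_nonneg hs k) ?_
      have := hT.mono ((hP k).le_self e he)
      rwa [hT.map_unit] at this
    refine apply_mem_mul (hLpos n) he (hb0 n) (hK hM) ((hLapp n e).trans_le (hK hN))
      (Finset.sum_nonneg fun k _ => pow_nonneg hs k)
      (fun β y => hcomm n _ (isBandProjection_aboveProj _ _ _) (hT.map_aboveProj (hTb n) β) y)
      (subset_supOf _ _ ⟨n, rfl⟩) (subset_supOf _ _ ⟨n, rfl⟩)
  · refine mul_supOf_le hT hLpos ?_ (monotone_sum_range fun k => hpos hM k e he) hb0 hTb hcomm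
      fun n => ?_
    · simp only [hLapp]
      exact monotone_sum_range fun k => hpos hN k e he
    · rw [hLb]
      refine (genSup e T _ s).lower' ((sum_rectangle_le_sum_triangle hf0 n n).trans_eq
        (hconv _).symm) (subset_supOf _ _ ⟨n + n, rfl⟩)

/-! ### Sums of independent families -/

theorem levelProj_unit_mem {e x : E} {T : E →ₗ[ℝ] E} (hT : IsConditionalTriple e T) (t : ℝ) :
    levelProj e x t e ∈ closedRieszSpan (insert x (Set.range T)) := by
  refine Submodule.mem_sInf.2 ?_
  rintro F ⟨hF, hS⟩
  have hx : x ∈ F := hS (Set.mem_insert _ _)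
  have he : e ∈ F := hS (Set.mem_insert_of_mem _ ⟨e, hT.map_unit⟩)
  have hu : |x - t • e| ∈ F := by
    have h := F.sub_mem hx (F.smul_mem t he)
    exact hF.sup_mem _ h _ (F.neg_mem h)
  refine F.sub_mem he (hF.lub_mem _ ?_ (Set.range_nonempty _) _
    (isLUB_bandProj |x - t • e| hT.unit_nonneg))
  rintro _ ⟨n, rfl⟩
  -- Closed Riesz subspaces are given through suprema; infima are reached by negation.
  have h : -(e ⊓ n • |x - t • e|) ∈ F := by
    rw [neg_inf]
    exact hF.sup_mem _ (F.neg_mem he) _ (F.neg_mem (F.nsmul_mem hu n))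
  simpa only [abs_abs, SetLike.mem_coe] using F.neg_mem_iff.1 h

theorem isLevels_zero {e : E} (he : 0 ≤ e) :
    IsLevels e 0 fun k => if k = 0 then LinearMap.id else (0 : E →ₗ[ℝ] E) where
  proj k := by
    split_ifs
    · exact IsBandProjection.id
    · exact IsBandProjection.zero
  disj j k hjk y := by
    by_cases hj : j = 0
    · subst hj
      simp [hjk.symm]
    · simp [hj]
  sup := by
    have h : ∀ n : ℕ, ∑ k ∈ Finset.range n, (if k = 0 then LinearMap.id else (0 : E →ₗ[ℝ] E)) e =
        if 0 < n then e else 0 := by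
      intro n
      rw [Finset.sum_congr rfl (g := fun k => if k = 0 then e else 0) fun k _ => by
        split_ifs <;> rfl]
      simp
    simp only [h]
    refine ⟨?_, fun w hw => ?_⟩
    · rintro _ ⟨n, rfl⟩
      simp only
      split_ifs
      · exact le_rfl
      · exact he
    · simpa using hw ⟨1, rfl⟩
  level k := by
    by_cases hk : k = 0
    · simp [hk]
    · simp [hk]

theorem genFun_zero {e : E} {T : E →ₗ[ℝ] E} (hT : IsConditionalTriple e T) (s : ℝ) :
    genFun e T 0 s = of e := by
  have he := hT.unit_nonneg
  rw [(isLevels_zero he).genFun_eq hT]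
  refine supOf_eq_of ?_
  have h := (isLevels_zero he).sup
  convert h using 3
  refine Finset.sum_congr rfl fun k _ => ?_
  by_cases hk : k = 0
  · simp [hk, hT.map_unit]
  · simp [hk]

variable {ι : Type*}

/-- The level projections of the sum of a finite family. -/
noncomputable def sumLevels (e : E) (x : ι → E) : List ι → ℕ → E →ₗ[ℝ] E
  | [] => fun k => if k = 0 then LinearMap.id else 0
  | i :: l => convPartition (fun k => levelProj e (x i) k) (sumLevels e x l)

theorem isLevels_sumLevels {e : E} {T : E →ₗ[ℝ] E} (hT : IsConditionalTriple e T) {x : ι → E}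
    (hx : ∀ i, IsNatural e T (x i)) (l : List ι) :
    IsLevels e (l.map x).sum (sumLevels e x l) := by
  induction l with
  | nil => exact isLevels_zero hT.unit_nonneg
  | cons i l ih =>
    rw [List.map_cons, List.sum_cons]
    exact ((hx i).isLevels hT).add hT.unit_nonneg ih

open Classical in
theorem foldr_levelProj_update (e : E) (x : ι → E) (κ : ι → ℕ) {i : ι} (k : ℕ) {l : List ι}
    (hi : i ∉ l) :
    l.foldr (fun j z => levelProj e (x j) (Function.update κ i k j : ℕ) z) e =
      l.foldr (fun j z => levelProj e (x j) (κ j) z) e := by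
  refine List.foldr_ext _ _ _ fun j hj z => ?_
  have hji : j ≠ i := by
    rintro rfl
    exact hi hj
  rw [Function.update_of_ne hji]

/-- Independence concerns products with one projection per index. This reduces the levels of a sum
to such products by linearity. -/
theorem sumLevels_mem_span (e : E) (x : ι → E) {l : List ι} (hl : l.Nodup) (m : ℕ) :
    sumLevels e x l m e ∈ Submodule.span ℝ (Set.range fun κ : ι → ℕ =>
      l.foldr (fun j z => levelProj e (x j) (κ j) z) e) := by
  classical
  induction l generalizing m with
  | nil =>
    simp only [sumLevels]
    split_ifs
    · exact Submodule.subset_span ⟨fun _ => 0, rfl⟩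
    · exact Submodule.zero_mem _
  | cons i l ih =>
    obtain ⟨hi, hl'⟩ := List.nodup_cons.1 hl
    simp only [sumLevels]
    rw [convPartition_apply]
    refine Submodule.sum_mem _ fun p _ => ?_
    have hmem := ih hl' p.2
    generalize sumLevels e x l p.2 e = y at hmem ⊢
    induction hmem using Submodule.span_induction with
    | mem y hy =>
      obtain ⟨κ, rfl⟩ := hy
      refine Submodule.subset_span ⟨Function.update κ i p.1, ?_⟩
      simp only [List.foldr_cons, Function.update_self]
      rw [foldr_levelProj_update e x κ p.1 hi]
    | zero => simp
    | add y z _ _ hy hz => rw [map_add]; exact Submodule.add_mem _ hy hz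
    | smul r y _ hy => rw [map_smul]; exact Submodule.smul_mem _ r hy

theorem IndepElements.map_levelProj_sumLevels {e : E} {T : E →ₗ[ℝ] E}
    (hT : IsConditionalTriple e T) {x : ι → E} (hind : IndepElements e T x) {i : ι} {l : List ι}
    (hl : (i :: l).Nodup) (k m : ℕ) :
    T (levelProj e (x i) k (sumLevels e x l m e)) =
      T (levelProj e (x i) k (T (sumLevels e x l m e))) := by
  classical
  obtain ⟨hi, hl'⟩ := List.nodup_cons.1 hl
  have hmem := sumLevels_mem_span e x hl' m
  generalize sumLevels e x l m e = y at hmem ⊢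
  induction hmem using Submodule.span_induction with
  | mem y hy =>
    obtain ⟨κ, rfl⟩ := hy
    -- One family of projections serves both lists, as i ∉ l. Independence along i :: l and along l,
    -- at e = Te, combine to insert T after the first projection.
    have h := hind (fun j => levelProj e (x j) (Function.update κ i k j : ℕ))
      (fun j => isBandProjection_levelProj _ _ _) fun j => levelProj_unit_mem hT _
    have h1 := h _ hl e
    have h2 := h _ hl' e
    rw [hT.map_unit] at h1 h2
    simp only [List.foldr_cons, Function.update_self] at h1
    rw [← h2, foldr_levelProj_update e x κ k hi] at h1
    exact h1
  | zero => simp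
  | add y z _ _ hy hz => simp only [map_add, hy, hz]
  | smul r y _ hy => simp only [map_smul, hy]

theorem genFun_list_sum {e : E} {T : E →ₗ[ℝ] E} (hT : IsConditionalTriple e T) {x : ι → E}
    (hx : ∀ i, IsNatural e T (x i)) (hind : IndepElements e T x) {l : List ι} (hl : l.Nodup)
    {s : ℝ} (hs : 0 ≤ s) :
    genFun e T (l.map x).sum s = prodList e (l.map fun i => genFun e T (x i) s) := by
  induction l with
  | nil => exact genFun_zero hT s
  | cons i l ih =>
    have hL := isLevels_sumLevels hT hx l
    have hi := (hx i).isLevels hT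
    rw [(isLevels_sumLevels hT hx (i :: l)).genFun_eq hT]
    refine (genSup_convPartition hT hi.proj hL.proj
      (hind.map_levelProj_sumLevels hT hl) hs).trans ?_
    rw [← hi.genFun_eq hT, ← hL.genFun_eq hT, ih (List.nodup_cons.1 hl).2]
    rfl

end Generating

end RieszGen

theorem mainTheorem5 {E : Type*} [ConditionallyCompleteLattice E] [AddCommGroup E]
    [IsOrderedAddMonoid E] [Module ℝ E] [IsOrderedModule ℝ E]
    (e : E) (T : E →ₗ[ℝ] E) (hT : RieszGen.IsConditionalTriple e T)
    (n : ℕ) (x : Fin n → E) (hx : ∀ i, RieszGen.IsNatural e T (x i))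
    (hind : RieszGen.IndepElements e T x) :
    RieszGen.IsNatural e T (∑ i, x i) ∧
    ∀ s : ℝ, 0 ≤ s →
      (∃ y : RieszGen.SupCompletion E,
        (∀ z, RieszGen.HasFunctionalValue e (∑ i, x i) (fun t => ((s ^ t : ℝ) : EReal)) z ↔
          z = y) ∧
        RieszGen.genFun e T (∑ i, x i) s = RieszGen.extend T y) ∧
      RieszGen.genFun e T (∑ i, x i) s =
        RieszGen.prodList e (List.ofFn fun i => RieszGen.genFun e T (x i) s) := by
  have hsum : ∑ i, x i = ((List.finRange n).map x).sum := by
    rw [← List.ofFn_eq_map, List.sum_ofFn]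
  have hnat : RieszGen.IsNatural e T (∑ i, x i) := by
    rw [hsum]
    exact (RieszGen.isLevels_sumLevels hT hx _).isNatural hT
  refine ⟨hnat, fun s hs => ⟨hnat.functionalValue hT hs, ?_⟩⟩
  rw [hsum, List.ofFn_eq_map]
  exact RieszGen.genFun_list_sum hT hx hind (List.nodup_finRange n) hs
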